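/- Let $\mathcal K,\mathcal H,\mathcal H_1,\mathcal H_2$ be separable complex Hilbert spaces, $\mathcal L(\cdot)$ the bounded operators and $\mathcal T(\cdot)$ the trace class operators on a Hilbert space; $\mathcal H_1\otimes\mathcal H_2$ is the Hilbert space tensor product. Let $(\Omega,\Sigma)$, $(\Omega',\Sigma')$ be measurable spaces with $\sigma$-finite measures $\nu$, $\nu'$. A state is a positive trace class operator of trace $1$; $\mathcal S(\mathcal H)$ is the set of states. A channel in $\mathcal C(\mathcal K;\mathcal H)$ is a unital, ultraweakly continuous (normal), completely positive linear map $\mathcal E:\mathcal L(\mathcal K)\to\mathcal L(\mathcal H)$; a Schrödinger channel $\mathcal T(\mathcal H)\to\mathcal T(\mathcal K)$ is a linear map $\mathcal F$ for which there is $\mathcal E\in\mathcal C(\mathcal K;\mathcal H)$ with $\mathrm{tr}[\mathcal F(T)B]=\mathrm{tr}[T\mathcal E(B)]$ for all $T,B$. An observable in $\mathcal O_\Sigma(\mathcal H)$ is a normalized positive operator valued measure (POVM) on $\Sigma$ with values in $\mathcal L(\mathcal H)$; $\mathcal O_\nu(\mathcal H)$ is the set of those which vanish on $\nu$-null sets.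 It is sharp if all its values are projections. An instrument in $\mathcal I_\Sigma(\mathcal K;\mathcal H)$ is a map $\Gamma:\Sigma\times\mathcal L(\mathcal K)\to\mathcal L(\mathcal H)$ such that every $\Gamma(\cdot,B)$ is a (weakly countably additive) operator measure, $\Gamma(\cdot,I)$ is a POVM, every $\Gamma(X,\cdot)$ is linear, normal and completely positive, and $\Gamma(\Omega,\cdot)\in\mathcal C(\mathcal K;\mathcal H)$; $\mathcal I_\nu(\mathcal K;\mathcal H)$ is the set of those with $\Gamma(X,\cdot)=0$ whenever $\nu(X)=0$. Extremal means: extreme point of the respective convex set; an extremal state is called pure. (a) Let $\varrho\in\mathcal S(\mathcal H_1\otimes\mathcal H_2)$ with partial traces $\varrho_1=\mathrm{tr}_{\mathcal H_2}[\varrho]$ and $\varrho_2=\mathrm{tr}_{\mathcal H_1}[\varrho]$. If $\varrho_1$ or $\varrho_2$ is pure, then $\varrho=\varrho_1\otimes\varrho_2$. (b)&(e) Let $\mathsf M_1\in\mathcal O_\nu(\mathcal H)$ and $\mathsf M_2\in\mathcal O_{\nu'}(\mathcal H)$ be jointly measurable, i.e. suppose that they have a joint observable: some $\mathsf M\in\mathcal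 O_{\nu\times\nu'}(\mathcal H)$ with $\mathsf M(X\times\Omega')=\mathsf M_1(X)$ and $\mathsf M(\Omega\times Y)=\mathsf M_2(Y)$ for all $X\in\Sigma$, $Y\in\Sigma'$. If $\mathsf M_1$ is extremal in $\mathcal O_\nu(\mathcal H)$ or $\mathsf M_2$ is extremal in $\mathcal O_{\nu'}(\mathcal H)$, then the joint observable is unique. If both are extremal, then the joint observable is extremal in $\mathcal O_{\nu\times\nu'}(\mathcal H)$. If $\mathsf M_1$ or $\mathsf M_2$ is sharp, then $\mathsf M_1(X)\mathsf M_2(Y)=\mathsf M_2(Y)\mathsf M_1(X)$ for all $X\in\Sigma$, $Y\in\Sigma'$, the joint observable is unique, and an $\mathsf M\in\mathcal O_{\nu\times\nu'}(\mathcal H)$ is this joint observable if and only if $\mathsf M(X\times Y)=\mathsf M_1(X)\mathsf M_2(Y)$ for all $X\in\Sigma$, $Y\in\Sigma'$. The same holds with $\mathcal O_\Sigma(\mathcal H)$, $\mathcal O_{\Sigma'}(\mathcal H)$, $\mathcal O_{\Sigma\otimes\Sigma'}(\mathcal H)$ in place of $\mathcal O_\nu(\mathcal H)$, $\mathcal O_{\nu'}(\mathcal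 H)$, $\mathcal O_{\nu\times\nu'}(\mathcal H)$. (c)&(f) Let $\mathsf M\in\mathcal O_\nu(\mathcal H)$ and $\mathcal E\in\mathcal C(\mathcal K;\mathcal H)$ be compatible, i.e. suppose that they have a joint instrument: some $\Gamma\in\mathcal I_\nu(\mathcal K;\mathcal H)$ with $\Gamma(\cdot,I)=\mathsf M$ and $\Gamma(\Omega,\cdot)=\mathcal E$. If $\mathsf M$ is extremal in $\mathcal O_\nu(\mathcal H)$ or $\mathcal E$ is extremal in $\mathcal C(\mathcal K;\mathcal H)$, then the joint instrument is unique. If both are extremal, then the joint instrument is extremal in $\mathcal I_\nu(\mathcal K;\mathcal H)$. If $\mathsf M$ is sharp or $\mathcal E$ is a *-representation, then $\mathsf M(X)\mathcal E(B)=\mathcal E(B)\mathsf M(X)$ for all $X\in\Sigma$, $B\in\mathcal L(\mathcal K)$, the joint instrument $\Gamma$ is unique, and $$\Gamma(X,B)=\mathsf M(X)\mathcal E(B)=\sqrt{\mathsf M(X)}\,\mathcal E(B)\sqrt{\mathsf M(X)},\qquad X\in\Sigma,\ B\in\mathcal L(\mathcal K).$$ The same holds with $\mathcal O_\Sigma(\mathcal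 H)$ and $\mathcal I_\Sigma(\mathcal K;\mathcal H)$ in place of $\mathcal O_\nu(\mathcal H)$ and $\mathcal I_\nu(\mathcal K;\mathcal H)$. (d) Let $\mathcal H\neq\{0\}$ and let $\mathcal F:\mathcal T(\mathcal H)\to\mathcal T(\mathcal H\otimes\mathcal H)$ be a Schrödinger channel such that the partial trace of $\mathcal F(T)$ over one fixed tensor factor (the first or the second) equals $T$ for all $T\in\mathcal T(\mathcal H)$. Then there is a state $\sigma\in\mathcal S(\mathcal H)$ such that the partial trace of $\mathcal F(T)$ over the other factor equals $\mathrm{tr}[T]\,\sigma$ for all $T\in\mathcal T(\mathcal H)$. -/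

import Mathlib

open MeasureTheory TensorProduct
open scoped ComplexOrder InnerProductSpace

noncomputable section

namespace QJoint

universe u v w

section TraceClass

variable (H : Type u) [NormedAddCommGroup H] [InnerProductSpace ℂ H] [CompleteSpace H]

/-- The index set of a fixed orthonormal (Hilbert) basis of `H`. -/
def basisIndex : Set H := (exists_hilbertBasis ℂ H).choose

/-- A fixed orthonormal (Hilbert) basis of `H`. -/
def basis : HilbertBasis (basisIndex H) ℂ H := (exists_hilbertBasis ℂ H).choose_spec.choose

/-- The trace class `𝒯(H)`: the linear span of the positive operators of finite trace. -/
def traceClass : Submodule ℂ (H →L[ℂ] H) :=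
  Submodule.span ℂ {T | 0 ≤ T ∧ Summable fun i => ⟪basis H i, T (basis H i)⟫_ℂ}

variable {H}

/-- The trace `∑ᵢ ⟨eᵢ, T eᵢ⟩`; meaningful for trace class operators. -/
def tr (T : H →L[ℂ] H) : ℂ := ∑' i, ⟪basis H i, T (basis H i)⟫_ℂ

variable (H)

/-- The states `𝒮(H)`: positive trace class operators of trace one. -/
def states : Set (H →L[ℂ] H) := {ρ | 0 ≤ ρ ∧ ρ ∈ traceClass H ∧ tr ρ = 1}

/-- The ultraweak topology of `ℒ(H)`: the coarsest topology that makes all the functionals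
`A ↦ tr (T A)`, with `T` trace class, continuous. -/
@[reducible] def ultraweak : TopologicalSpace (H →L[ℂ] H) :=
  TopologicalSpace.induced (fun A (T : traceClass H) => tr (T.1 * A)) inferInstance

end TraceClass

section Tensor

/-- The Hilbert space tensor product: the completion of the algebraic tensor product. -/
abbrev HTensor (H₁ : Type u) (H₂ : Type v) [NormedAddCommGroup H₁] [InnerProductSpace ℂ H₁]
    [NormedAddCommGroup H₂] [InnerProductSpace ℂ H₂] : Type (max u v) :=
  UniformSpace.Completion (H₁ ⊗[ℂ] H₂)

variable {H₁ : Type u} [NormedAddCommGroup H₁] [InnerProductSpace ℂ H₁]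
variable {H₂ : Type v} [NormedAddCommGroup H₂] [InnerProductSpace ℂ H₂]

/-- The tensor product `A ⊗ B` of bounded operators, acting on the Hilbert tensor product. -/
def opTensor (A : H₁ →L[ℂ] H₁) (B : H₂ →L[ℂ] H₂) : HTensor H₁ H₂ →L[ℂ] HTensor H₁ H₂ :=
  (TensorProduct.mapL A B).completion

/-- The bounded operator `φ ↦ φ ⊗ ψ`. -/
def tensorRight (ψ : H₂) : H₁ →L[ℂ] HTensor H₁ H₂ :=
  UniformSpace.Completion.toComplL ∘L (TensorProduct.mkL ℂ H₁ H₂).flip ψ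

/-- The bounded operator `ψ ↦ φ ⊗ ψ`. -/
def tensorLeft (φ : H₁) : H₂ →L[ℂ] HTensor H₁ H₂ :=
  UniformSpace.Completion.toComplL ∘L TensorProduct.mkL ℂ H₁ H₂ φ

variable [CompleteSpace H₁] [CompleteSpace H₂]

/-- The partial trace over the second factor, `tr_{H₂} : 𝒯(H₁ ⊗ H₂) → 𝒯(H₁)`: if `(fⱼ)` is the
basis of `H₂` and `Vⱼ φ = φ ⊗ fⱼ`, it is `∑ⱼ Vⱼ* ρ Vⱼ`, a norm convergent sum for trace
class `ρ`. -/
def ptraceSnd (ρ : HTensor H₁ H₂ →L[ℂ] HTensor H₁ H₂) : H₁ →L[ℂ] H₁ :=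
  ∑' j, (tensorRight (basis H₂ j)).adjoint ∘L ρ ∘L tensorRight (basis H₂ j)

/-- The partial trace over the first factor, `tr_{H₁} : 𝒯(H₁ ⊗ H₂) → 𝒯(H₂)`. -/
def ptraceFst (ρ : HTensor H₁ H₂ →L[ℂ] HTensor H₁ H₂) : H₂ →L[ℂ] H₂ :=
  ∑' i, (tensorLeft (basis H₁ i)).adjoint ∘L ρ ∘L tensorLeft (basis H₁ i)

end Tensor

section Channels

variable {K : Type u} [NormedAddCommGroup K] [InnerProductSpace ℂ K] [CompleteSpace K]
variable {H : Type v} [NormedAddCommGroup H] [InnerProductSpace ℂ H] [CompleteSpace H]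

/-- Complete positivity of a linear map `Φ : ℒ(K) → ℒ(H)`. -/
def IsCP (Φ : (K →L[ℂ] K) →ₗ[ℂ] (H →L[ℂ] H)) : Prop :=
  ∀ (n : ℕ) (a : Fin n → K →L[ℂ] K) (φ : Fin n → H),
    0 ≤ ∑ j, ∑ k, ⟪φ j, Φ (star (a j) * a k) (φ k)⟫_ℂ

/-- Normality of a linear map `Φ : ℒ(K) → ℒ(H)`: continuity for the ultraweak topologies. -/
def IsNormalMap (Φ : (K →L[ℂ] K) →ₗ[ℂ] (H →L[ℂ] H)) : Prop :=
  @Continuous _ _ (ultraweak K) (ultraweak H) Φ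

/-- A *-representation `ℒ(K) → ℒ(H)` (unital whenever it is a channel). -/
def IsStarRep (Φ : (K →L[ℂ] K) →ₗ[ℂ] (H →L[ℂ] H)) : Prop :=
  (∀ A B, Φ (A * B) = Φ A * Φ B) ∧ ∀ A, Φ (star A) = star (Φ A)

variable (K H)

/-- The channels `𝒞(K; H)`, in the Heisenberg picture: unital normal completely positive maps
`ℒ(K) → ℒ(H)`. -/
def channels : Set ((K →L[ℂ] K) →ₗ[ℂ] (H →L[ℂ] H)) :=
  {E | IsCP E ∧ IsNormalMap E ∧ E 1 = 1}

variable {K H}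

/-- A Schrödinger channel `𝒯(H) → 𝒯(K)`: the predual map of a channel in `𝒞(K; H)`. -/
def IsSchrodingerChannel (F : traceClass H →ₗ[ℂ] traceClass K) : Prop :=
  ∃ E ∈ channels K H, ∀ (T : traceClass H) (B : K →L[ℂ] K),
    tr ((F T).1 * B) = tr (T.1 * E B)

end Channels

section Measures

variable {Ω : Type u} [MeasurableSpace Ω]
variable {H : Type v} [NormedAddCommGroup H] [InnerProductSpace ℂ H] [CompleteSpace H]

/-- `M` is an operator measure: countably additive on the σ-algebra in the weak operator topology.
A set function is extended by `0` to the non-measurable sets, as for Mathlib's vector measures. -/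
def IsOperatorMeasure (M : Set Ω → H →L[ℂ] H) : Prop :=
  (∀ X, ¬ MeasurableSet X → M X = 0) ∧
  ∀ X : ℕ → Set Ω, (∀ n, MeasurableSet (X n)) → Pairwise (fun m n => Disjoint (X m) (X n)) →
    ∀ φ ψ : H, HasSum (fun n => ⟪φ, M (X n) ψ⟫_ℂ) ⟪φ, M (⋃ n, X n) ψ⟫_ℂ

/-- Sharpness of an observable: it is projection valued. -/
def IsSharp (M : Set Ω → H →L[ℂ] H) : Prop := ∀ X, MeasurableSet X → IsStarProjection (M X)

variable (Ω H)

/-- The observables `𝒪_Σ(H)`: normalized positive operator valued measures. -/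
def observables : Set (Set Ω → H →L[ℂ] H) :=
  {M | IsOperatorMeasure M ∧ (∀ X, 0 ≤ M X) ∧ M Set.univ = 1}

variable {Ω}

/-- The observables `𝒪_ν(H)`: normalized positive operator valued measures that are absolutely
continuous with respect to `ν`. -/
def observablesOn (ν : Measure Ω) : Set (Set Ω → H →L[ℂ] H) :=
  {M ∈ observables Ω H | ∀ X, MeasurableSet X → ν X = 0 → M X = 0}

variable {H}

/-- `M` has the marginals `M₁` and `M₂`. -/
def IsJointObservable {Ω' : Type w} [MeasurableSpace Ω'] (M : Set (Ω × Ω') → H →L[ℂ] H)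
    (M₁ : Set Ω → H →L[ℂ] H) (M₂ : Set Ω' → H →L[ℂ] H) : Prop :=
  (∀ X, MeasurableSet X → M (X ×ˢ Set.univ) = M₁ X) ∧
  (∀ Y, MeasurableSet Y → M (Set.univ ×ˢ Y) = M₂ Y)

variable (Ω H)
variable (K : Type w) [NormedAddCommGroup K] [InnerProductSpace ℂ K] [CompleteSpace K]

/-- The instruments `ℐ_Σ(K; H)`, as maps `(X, B) ↦ Γ X B`. -/
def instruments : Set (Set Ω → (K →L[ℂ] K) →ₗ[ℂ] (H →L[ℂ] H)) :=
  {Γ | (∀ B, IsOperatorMeasure fun X => Γ X B) ∧ (fun X => Γ X 1) ∈ observables Ω H ∧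
    (∀ X, IsCP (Γ X) ∧ IsNormalMap (Γ X)) ∧ Γ Set.univ ∈ channels K H}

variable {Ω}

/-- The instruments `ℐ_ν(K; H)`: those that are absolutely continuous with respect to `ν`. -/
def instrumentsOn (ν : Measure Ω) : Set (Set Ω → (K →L[ℂ] K) →ₗ[ℂ] (H →L[ℂ] H)) :=
  {Γ ∈ instruments Ω H K | ∀ X, MeasurableSet X → ν X = 0 → Γ X = 0}

variable {H K}

/-- `Γ` has the marginal observable `M` and the marginal channel `E`. -/
def IsJointInstrument (Γ : Set Ω → (K →L[ℂ] K) →ₗ[ℂ] (H →L[ℂ] H)) (M : Set Ω → H →L[ℂ] H)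
    (E : (K →L[ℂ] K) →ₗ[ℂ] (H →L[ℂ] H)) : Prop :=
  (∀ X, MeasurableSet X → Γ X 1 = M X) ∧ Γ Set.univ = E

end Measures

end QJoint

end

open QJoint

set_option linter.unusedSectionVars false

namespace QJoint

/-! ### Positive operators and projections -/

section Operators

variable {H : Type*} [NormedAddCommGroup H] [InnerProductSpace ℂ H] [CompleteSpace H]

/-! Uniqueness of joint objects comes from a swap. If `M` and `N` have the same marginals and `Z = Ω
× Y`, then X ↦ M(X × Y) + N(X × Yᶜ) is again an observable, because `M Z = N Z`; the version with
`M` and `N` exchanged is one too, and the two average to `M₁`. If `M₁` is extremal, both equal `M₁`,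
and cancelling gives M(X × Y) = N(X × Y). For instruments the mixtures are Γ(·, B) + Δ(·, 1 - B)
with 0 ≤ B ≤ 1 when the observable is extremal, and Γ(X) + Δ(Xᶜ) when the channel is. If both
marginals are extremal, every convex decomposition of the joint object has these same marginals, so
uniqueness makes it trivial. The carriers are `apply_preimage_inter_eq_of_extreme` and
`IsJointInstrument.unique`.

The product formulas rest on `eq_mul_add_of_le_projection` when an observable is sharp, and on a
Cauchy–Schwarz argument, `IsCP.eq_mul_of_isStarRep_add`, when the channel is a representation.

For states, each slice of `ρ` along a unit vector is dominated by the partial trace. If that is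
pure, all slices are multiples of it and polarization gives a product
(`exists_inner_eq_mul_of_isPure`). Broadcasting applies this to pure inputs: the output is C(φ) on
one factor times |φ⟩⟨φ| on the other. Linearity of the dual channel makes ⟨α, C(φ)α'⟩ |⟨c, φ⟩|² a
quadratic form in φ for every c, which forces C(φ) to be constant (`eq_of_forall_inner_eq_mul`). -/

lemma op_nonneg_iff {A : H →L[ℂ] H} : 0 ≤ A ↔ ∀ x, 0 ≤ ⟪x, A x⟫_ℂ := by
  rw [ContinuousLinearMap.nonneg_iff_isPositive]
  refine ⟨fun h x => h.inner_nonneg_right x, fun h => ?_⟩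
  rw [ContinuousLinearMap.isPositive_iff_complex]
  intro x
  have h1 := h x
  rw [← inner_conj_symm, ← RCLike.star_def, star_nonneg_iff] at h1
  obtain ⟨h2, h3⟩ := Complex.nonneg_iff.1 h1
  exact ⟨Complex.ext (by simp) (by simpa using h3), h2⟩

lemma op_le_iff {A B : H →L[ℂ] H} : A ≤ B ↔ ∀ x, ⟪x, A x⟫_ℂ ≤ ⟪x, B x⟫_ℂ := by
  rw [← sub_nonneg, op_nonneg_iff]
  simp

/-- The square root turns the quadratic form of a positive operator into a squared norm. -/
lemma inner_eq_inner_sqrt {A : H →L[ℂ] H} (hA : 0 ≤ A) (x y : H) :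
    ⟪x, A y⟫_ℂ = ⟪CFC.sqrt A x, CFC.sqrt A y⟫_ℂ := by
  have hs : IsSelfAdjoint (CFC.sqrt A) := (CFC.sqrt_nonneg A).isSelfAdjoint
  have h : CFC.sqrt A * CFC.sqrt A = A := CFC.sqrt_mul_sqrt_self A
  conv_lhs => rw [← h]
  rw [mul_apply_eq_comp, ← ContinuousLinearMap.adjoint_inner_left,
    ← ContinuousLinearMap.star_eq_adjoint, hs.star_eq]

lemma apply_eq_zero_of_inner_eq_zero {A : H →L[ℂ] H} (hA : 0 ≤ A) {x : H}
    (hx : ⟪x, A x⟫_ℂ = 0) : A x = 0 := by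
  rw [inner_eq_inner_sqrt hA, inner_self_eq_zero] at hx
  have h : CFC.sqrt A * CFC.sqrt A = A := CFC.sqrt_mul_sqrt_self A
  rw [← h, mul_apply_eq_comp, hx, map_zero]

/-- On the kernel of `P` the quadratic form of `A` is squeezed to zero, hence so is `A`; taking
adjoints gives the other side. -/
lemma mul_eq_self_of_le_projection {A P : H →L[ℂ] H} (hA : 0 ≤ A) (hP : IsStarProjection P)
    (h : A ≤ P) : A * P = A ∧ P * A = A := by
  have h1 : A * P = A := by
    ext x
    have h2 : P (x - P x) = 0 := by
      rw [map_sub, ← mul_apply_eq_comp, hP.isIdempotentElem.eq, sub_self]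
    have h3 : A (x - P x) = 0 := by
      refine apply_eq_zero_of_inner_eq_zero hA (le_antisymm ?_ (op_nonneg_iff.1 hA _))
      simpa [h2] using op_le_iff.1 h (x - P x)
    rw [map_sub, sub_eq_zero] at h3
    exact h3.symm
  refine ⟨h1, ?_⟩
  have h4 := congrArg star h1
  rwa [star_mul, hP.isSelfAdjoint.star_eq, hA.isSelfAdjoint.star_eq] at h4

/-- `P` fixes `A` and annihilates `B` from either side. This is the common core of the sharp cases
for observables and instruments. -/
lemma eq_mul_add_of_le_projection {A B P : H →L[ℂ] H} (hA : 0 ≤ A) (hB : 0 ≤ B)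
    (hP : IsStarProjection P) (hAP : A ≤ P) (hBP : B ≤ 1 - P) :
    A = P * (A + B) ∧ A = (A + B) * P := by
  have h2 := mul_eq_self_of_le_projection hA hP hAP
  have h3 := mul_eq_self_of_le_projection hB hP.one_sub hBP
  rw [mul_sub, sub_mul, mul_one, one_mul, sub_eq_self, sub_eq_self] at h3
  rw [mul_add, add_mul, h2.1, h2.2, h3.1, h3.2]
  simp

end Operators

lemma eq_of_add_eq_add_self {V : Type*} [AddCommGroup V] [Module ℝ V] {S : Set V} {x y z : V}
    (hx : x ∈ S.extremePoints ℝ) (hy : y ∈ S) (hz : z ∈ S) (h : y + z = x + x) : y = x := by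
  refine hx.2 hy hz ⟨1 / 2, 1 / 2, by norm_num, by norm_num, by norm_num, ?_⟩
  rw [← smul_add, h, ← two_smul ℝ x, smul_smul]
  norm_num

/-! ### Joint observables -/

section Measures

variable {Ω Ω' Θ : Type*} [MeasurableSpace Ω] [MeasurableSpace Ω'] [MeasurableSpace Θ]
variable {H : Type*} [NormedAddCommGroup H] [InnerProductSpace ℂ H] [CompleteSpace H]

namespace IsOperatorMeasure

variable {M N : Set Ω → H →L[ℂ] H}

/-- The complex measure `X ↦ ⟨φ, M(X) ψ⟩`. -/
noncomputable def matrixElement (hM : IsOperatorMeasure M) (φ ψ : H) : VectorMeasure Ω ℂ where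
  measureOf' X := ⟪φ, M X ψ⟫_ℂ
  empty' := by
    -- A constant sequence over ℕ is summable only if the constant is zero.
    have h := hM.2 (fun _ => ∅) (fun _ => MeasurableSet.empty) (fun _ _ _ => disjoint_bot_left) φ ψ
    exact (summable_const_iff _).1 h.summable
  not_measurable' X hX := by simp [hM.1 X hX]
  m_iUnion' f hf hd := hM.2 f hf hd φ ψ

lemma union (hM : IsOperatorMeasure M) {X Y : Set Ω} (hX : MeasurableSet X) (hY : MeasurableSet Y)
    (h : Disjoint X Y) : M (X ∪ Y) = M X + M Y := by
  refine ContinuousLinearMap.ext fun ψ => ext_inner_left ℂ fun φ => ?_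
  rw [add_apply, inner_add_right]
  exact (hM.matrixElement φ ψ).of_union h hX hY

lemma inter_add_inter_compl (hM : IsOperatorMeasure M) {X Y : Set Ω} (hX : MeasurableSet X)
    (hY : MeasurableSet Y) : M (X ∩ Y) + M (X ∩ Yᶜ) = M X := by
  rw [← hM.union (hX.inter hY) (hX.inter hY.compl)
    (disjoint_compl_right.mono Set.inter_subset_right Set.inter_subset_right),
    Set.inter_union_compl]

lemma add (hM : IsOperatorMeasure M) (hN : IsOperatorMeasure N) : IsOperatorMeasure (M + N) := by
  refine ⟨fun X hX => by simp [hM.1 X hX, hN.1 X hX], fun X hX hd φ ψ => ?_⟩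
  simpa [inner_add_right] using (hM.2 X hX hd φ ψ).add (hN.2 X hX hd φ ψ)

lemma ext_prod {M N : Set (Ω × Ω') → H →L[ℂ] H} (hM : IsOperatorMeasure M)
    (hN : IsOperatorMeasure N)
    (h : ∀ X Y, MeasurableSet X → MeasurableSet Y → M (X ×ˢ Y) = N (X ×ˢ Y)) : M = N := by
  have h1 : ∀ φ ψ, hM.matrixElement φ ψ = hN.matrixElement φ ψ := by
    intro φ ψ
    have h2 : ∀ X Y, MeasurableSet X → MeasurableSet Y →
        hM.matrixElement φ ψ (X ×ˢ Y) = hN.matrixElement φ ψ (X ×ˢ Y) := fun X Y hX hY =>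
      congrArg (fun A : H →L[ℂ] H => ⟪φ, A ψ⟫_ℂ) (h X Y hX hY)
    refine VectorMeasure.ext_of_generateFrom _ ?_ generateFrom_prod.symm isPiSystem_prod ?_
    · rintro _ ⟨X, hX, Y, hY, rfl⟩
      exact h2 X Y hX hY
    · simpa using h2 Set.univ Set.univ .univ .univ
  ext Z : 1
  refine ContinuousLinearMap.ext fun ψ => ext_inner_left ℂ fun φ => ?_
  exact DFunLike.congr_fun (h1 φ ψ) Z

end IsOperatorMeasure

open Classical in
/-- The image under `f` of the restriction of `M` to `Z`. -/
noncomputable def restrictMap {V : Type*} [Zero V] (f : Θ → Ω) (Z : Set Θ) (M : Set Θ → V)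
    (X : Set Ω) : V :=
  if MeasurableSet X then M (f ⁻¹' X ∩ Z) else 0

lemma restrictMap_apply {V : Type*} [Zero V] {f : Θ → Ω} {Z : Set Θ} {M : Set Θ → V} {X : Set Ω}
    (hX : MeasurableSet X) : restrictMap f Z M X = M (f ⁻¹' X ∩ Z) := if_pos hX

lemma restrictMap_of_not {V : Type*} [Zero V] {f : Θ → Ω} {Z : Set Θ} {M : Set Θ → V} {X : Set Ω}
    (hX : ¬ MeasurableSet X) : restrictMap f Z M X = 0 := if_neg hX

lemma restrictMap_nonneg {f : Θ → Ω} {Z : Set Θ} {M : Set Θ → H →L[ℂ] H} (hM : ∀ X, 0 ≤ M X)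
    (X : Set Ω) : 0 ≤ restrictMap f Z M X := by
  unfold restrictMap
  split_ifs
  exacts [hM _, le_rfl]

lemma IsOperatorMeasure.restrictMap {f : Θ → Ω} {Z : Set Θ} {M : Set Θ → H →L[ℂ] H}
    (hM : IsOperatorMeasure M) (hf : Measurable f) (hZ : MeasurableSet Z) :
    IsOperatorMeasure (restrictMap f Z M) := by
  refine ⟨fun X hX => restrictMap_of_not hX, fun X hX hd φ ψ => ?_⟩
  have h := hM.2 (fun n => f ⁻¹' X n ∩ Z) (fun n => (hf (hX n)).inter hZ)
    (fun m n hmn => ((hd hmn).preimage f).mono Set.inter_subset_left Set.inter_subset_left) φ ψ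
  rw [restrictMap_apply (MeasurableSet.iUnion hX), Set.preimage_iUnion, Set.iUnion_inter]
  simpa only [restrictMap_apply (hX _)] using h

variable (H) in
/-- The observables that vanish on the measurable sets with the property `p`. -/
def observablesNull (p : Set Ω → Prop) : Set (Set Ω → H →L[ℂ] H) :=
  {M ∈ observables Ω H | ∀ X, MeasurableSet X → p X → M X = 0}

/-- The predicate treats both versions at once: `ν X = 0` gives `observablesOn` by definition, and
`False` imposes no condition. -/
lemma observablesNull_false : observablesNull H (fun _ : Set Ω => False) = observables Ω H := by
  simp [observablesNull]

lemma restrictMap_univ_mem_observablesNull {f : Θ → Ω} {M : Set Θ → H →L[ℂ] H} {p : Set Ω → Prop}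
    {q : Set Θ → Prop} (hM : M ∈ observablesNull H q) (hf : Measurable f)
    (hpq : ∀ X, MeasurableSet X → p X → q (f ⁻¹' X)) :
    restrictMap f Set.univ M ∈ observablesNull H p := by
  refine ⟨⟨hM.1.1.restrictMap hf .univ, restrictMap_nonneg hM.1.2.1, ?_⟩, fun X hX hp => ?_⟩
  · simp [restrictMap_apply, hM.1.2.2]
  · simpa [restrictMap_apply hX] using hM.2 _ (hf hX) (hpq X hX hp)

/-- Two observables that have the same image under `f`, an extremal one, and agree on `Z`, also
agree on the sets `f⁻¹(X) ∩ Z`. -/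
lemma apply_preimage_inter_eq_of_extreme {M N : Set Θ → H →L[ℂ] H} {M₁ : Set Ω → H →L[ℂ] H}
    {p : Set Ω → Prop} (hM₁ : M₁ ∈ (observablesNull H p).extremePoints ℝ)
    (hM : M ∈ observables Θ H) (hN : N ∈ observables Θ H) {f : Θ → Ω} (hf : Measurable f)
    (hMf : ∀ X, MeasurableSet X → M (f ⁻¹' X) = M₁ X)
    (hNf : ∀ X, MeasurableSet X → N (f ⁻¹' X) = M₁ X) {Z : Set Θ} (hZ : MeasurableSet Z)
    (hMN : M Z = N Z) {X : Set Ω} (hX : MeasurableSet X) :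
    M (f ⁻¹' X ∩ Z) = N (f ⁻¹' X ∩ Z) := by
  have key : ∀ M N : Set Θ → H →L[ℂ] H, M ∈ observables Θ H → N ∈ observables Θ H →
      (∀ X, MeasurableSet X → M (f ⁻¹' X) = M₁ X) → (∀ X, MeasurableSet X → N (f ⁻¹' X) = M₁ X) →
      M Z = N Z → restrictMap f Z M + restrictMap f Zᶜ N ∈ observablesNull H p := by
    intro M N hM hN hMf hNf hMN
    refine ⟨⟨(hM.1.restrictMap hf hZ).add (hN.1.restrictMap hf hZ.compl), fun X =>
      add_nonneg (restrictMap_nonneg hM.2.1 X) (restrictMap_nonneg hN.2.1 X), ?_⟩,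
      fun X hX hp => ?_⟩
    -- Agreement on `Z` is what normalizes the mixture: M(Z) + N(Zᶜ) = N(Z) + N(Zᶜ) = 1.
    · have := hN.1.inter_add_inter_compl .univ hZ
      simpa [restrictMap_apply, hMN, hN.2.2] using this
    -- Both pieces are positive and bounded by M₁(X) = 0.
    · have h0 := hM₁.1.2 X hX hp
      have h1 := hM.1.inter_add_inter_compl (hf hX) hZ
      have h2 := hN.1.inter_add_inter_compl (hf hX) hZ
      rw [hMf X hX, h0] at h1
      rw [hNf X hX, h0] at h2
      have h3 := ((add_eq_zero_iff_of_nonneg (hM.2.1 _) (hM.2.1 _)).1 h1).1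
      have h4 := ((add_eq_zero_iff_of_nonneg (hN.2.1 _) (hN.2.1 _)).1 h2).2
      simp [restrictMap_apply hX, h3, h4]
  have h := eq_of_add_eq_add_self hM₁ (key M N hM hN hMf hNf hMN) (key N M hN hM hNf hMf hMN.symm)
    (by
      ext Y : 1
      by_cases hY : MeasurableSet Y
      · simp only [Pi.add_apply, restrictMap_apply hY]
        have h1 := hM.1.inter_add_inter_compl (hf hY) hZ
        have h2 := hN.1.inter_add_inter_compl (hf hY) hZ
        rw [hMf Y hY] at h1
        rw [hNf Y hY] at h2
        refine Eq.trans ?_ (congrArg₂ (· + ·) h1 h2)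
        abel
      · simp [restrictMap_of_not hY, hM₁.1.1.1.1 Y hY])
  have h1 := congrFun h X
  rw [Pi.add_apply, restrictMap_apply hX, restrictMap_apply hX, ← hNf X hX,
    ← hN.1.inter_add_inter_compl (hf hX) hZ] at h1
  exact add_right_cancel h1

/-- An observable is multiplicative at an intersection with a set where it is a projection. -/
lemma apply_inter_of_isStarProjection {M : Set Θ → H →L[ℂ] H} (hM : M ∈ observables Θ H)
    {S Z : Set Θ} (hS : MeasurableSet S) (hZ : MeasurableSet Z) (hP : IsStarProjection (M S)) :
    M (S ∩ Z) = M S * M Z ∧ M (S ∩ Z) = M Z * M S := by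
  have hle : ∀ {S}, MeasurableSet S → M (S ∩ Z) ≤ M S := fun {S} hS => by
    rw [← hM.1.inter_add_inter_compl hS hZ]
    exact le_add_of_nonneg_right (hM.2.1 _)
  have h1 : M Sᶜ = 1 - M S := by
    have := hM.1.inter_add_inter_compl .univ hS
    rw [Set.univ_inter, Set.univ_inter, hM.2.2] at this
    exact eq_sub_of_add_eq' this
  have h4 := hM.1.inter_add_inter_compl hZ hS
  rw [Set.inter_comm Z, Set.inter_comm Z] at h4
  rw [← h4]
  -- M(Z) is the sum of M(S ∩ Z) ≤ M(S) and M(Sᶜ ∩ Z) ≤ 1 - M(S).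
  exact eq_mul_add_of_le_projection (hM.2.1 _) (hM.2.1 _) hP (hle hS) (h1 ▸ hle hS.compl)

lemma IsJointObservable.iff_preimage {M : Set (Ω × Ω') → H →L[ℂ] H} {M₁ : Set Ω → H →L[ℂ] H}
    {M₂ : Set Ω' → H →L[ℂ] H} : IsJointObservable M M₁ M₂ ↔
    (∀ X, MeasurableSet X → M (Prod.fst ⁻¹' X) = M₁ X) ∧
    ∀ Y, MeasurableSet Y → M (Prod.snd ⁻¹' Y) = M₂ Y := by
  simp [IsJointObservable, Set.prod_univ, Set.univ_prod]

/-- A rectangle is an intersection of two preimages: the extremal marginal controls one of them, and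
the other marginal supplies agreement on the other. Rectangles determine the observable. -/
lemma IsJointObservable.unique {M N : Set (Ω × Ω') → H →L[ℂ] H} {M₁ : Set Ω → H →L[ℂ] H}
    {M₂ : Set Ω' → H →L[ℂ] H} {p : Set Ω → Prop} {p' : Set Ω' → Prop}
    (hext : M₁ ∈ (observablesNull H p).extremePoints ℝ ∨
      M₂ ∈ (observablesNull H p').extremePoints ℝ)
    (hM : M ∈ observables (Ω × Ω') H) (hN : N ∈ observables (Ω × Ω') H)
    (hMj : IsJointObservable M M₁ M₂) (hNj : IsJointObservable N M₁ M₂) : M = N := by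
  rw [IsJointObservable.iff_preimage] at hMj hNj
  refine hM.1.ext_prod hN.1 fun X Y hX hY => ?_
  rw [Set.prod_eq]
  rcases hext with h | h
  · exact apply_preimage_inter_eq_of_extreme h hM hN measurable_fst hMj.1 hNj.1
      (measurable_snd hY) ((hMj.2 Y hY).trans (hNj.2 Y hY).symm) hX
  · rw [Set.inter_comm]
    exact apply_preimage_inter_eq_of_extreme h hM hN measurable_snd hMj.2 hNj.2
      (measurable_fst hX) ((hMj.1 X hX).trans (hNj.1 X hX).symm) hY

lemma IsJointObservable.apply_prod_of_isSharp {M : Set (Ω × Ω') → H →L[ℂ] H}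
    {M₁ : Set Ω → H →L[ℂ] H} {M₂ : Set Ω' → H →L[ℂ] H} (hs : IsSharp M₁ ∨ IsSharp M₂)
    (hM : M ∈ observables (Ω × Ω') H) (hMj : IsJointObservable M M₁ M₂) {X : Set Ω} {Y : Set Ω'}
    (hX : MeasurableSet X) (hY : MeasurableSet Y) :
    M (X ×ˢ Y) = M₁ X * M₂ Y ∧ M (X ×ˢ Y) = M₂ Y * M₁ X := by
  rw [IsJointObservable.iff_preimage] at hMj
  rw [Set.prod_eq, ← hMj.1 X hX, ← hMj.2 Y hY]
  rcases hs with h | h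
  · exact apply_inter_of_isStarProjection hM (measurable_fst hX) (measurable_snd hY)
      (by rw [hMj.1 X hX]; exact h X hX)
  · rw [Set.inter_comm]
    exact (apply_inter_of_isStarProjection hM (measurable_snd hY) (measurable_fst hX)
      (by rw [hMj.2 Y hY]; exact h Y hY)).symm

lemma joint_observables {p : Set Ω → Prop} {p' : Set Ω' → Prop} {q : Set (Ω × Ω') → Prop}
    (hpq : ∀ X, MeasurableSet X → p X → q (Prod.fst ⁻¹' X))
    (hpq' : ∀ Y, MeasurableSet Y → p' Y → q (Prod.snd ⁻¹' Y)) :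
    ∀ M₁ ∈ observablesNull H p, ∀ M₂ ∈ observablesNull H p',
    (∃ M ∈ observablesNull H q, IsJointObservable M M₁ M₂) →
    ((M₁ ∈ (observablesNull H p).extremePoints ℝ ∨ M₂ ∈ (observablesNull H p').extremePoints ℝ) →
      ∃! M, M ∈ observablesNull H q ∧ IsJointObservable M M₁ M₂) ∧
    (M₁ ∈ (observablesNull H p).extremePoints ℝ → M₂ ∈ (observablesNull H p').extremePoints ℝ →
      ∀ M ∈ observablesNull H q, IsJointObservable M M₁ M₂ →
        M ∈ (observablesNull H q).extremePoints ℝ) ∧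
    ((IsSharp M₁ ∨ IsSharp M₂) →
      (∀ X Y, MeasurableSet X → MeasurableSet Y → Commute (M₁ X) (M₂ Y)) ∧
      (∃! M, M ∈ observablesNull H q ∧ IsJointObservable M M₁ M₂) ∧
      ∀ M ∈ observablesNull H q, (IsJointObservable M M₁ M₂ ↔
        ∀ X Y, MeasurableSet X → MeasurableSet Y → M (X ×ˢ Y) = M₁ X * M₂ Y)) := by
  rintro M₁ hM₁ M₂ hM₂ ⟨M, hM, hMj⟩
  refine ⟨fun h => ⟨M, ⟨hM, hMj⟩, fun N hN => hN.2.unique h hN.1.1 hM.1 hMj⟩,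
    fun h₁ h₂ M hM hMj => ⟨hM, ?_⟩, fun hs => ⟨fun X Y hX hY => ?_, ⟨M, ⟨hM, hMj⟩, ?_⟩, ?_⟩⟩
  -- The marginals of `N` and `N'` decompose `M₁` and `M₂`, so extremality gives `N` the marginals
  -- of `M`.
  · rintro N hN N' hN' ⟨a, b, ha, hb, hab, rfl⟩
    rw [IsJointObservable.iff_preimage] at hMj
    have e₁ : restrictMap Prod.fst Set.univ N = M₁ :=
      h₁.2 (restrictMap_univ_mem_observablesNull hN measurable_fst hpq)
        (restrictMap_univ_mem_observablesNull hN' measurable_fst hpq) ⟨a, b, ha, hb, hab, by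
          ext X : 1
          by_cases hX : MeasurableSet X
          · simpa [restrictMap_apply hX] using hMj.1 X hX
          · simp [restrictMap_of_not hX, hM₁.1.1.1 X hX]⟩
    have e₂ : restrictMap Prod.snd Set.univ N = M₂ :=
      h₂.2 (restrictMap_univ_mem_observablesNull hN measurable_snd hpq')
        (restrictMap_univ_mem_observablesNull hN' measurable_snd hpq') ⟨a, b, ha, hb, hab, by
          ext X : 1
          by_cases hX : MeasurableSet X
          · simpa [restrictMap_apply hX] using hMj.2 X hX
          · simp [restrictMap_of_not hX, hM₂.1.1.1 X hX]⟩
    refine IsJointObservable.unique (p' := p') (.inl h₁) hN.1 hM.1 ?_ (IsJointObservable.iff_preimage.2 hMj)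
    refine IsJointObservable.iff_preimage.2 ⟨fun X hX => ?_, fun Y hY => ?_⟩
    · simpa [restrictMap_apply hX] using congrFun e₁ X
    · simpa [restrictMap_apply hY] using congrFun e₂ Y
  · have h := hMj.apply_prod_of_isSharp hs hM.1 hX hY
    exact h.1.symm.trans h.2
  · rintro N ⟨hN, hNj⟩
    refine hN.1.1.ext_prod hM.1.1 fun X Y hX hY => ?_
    rw [(hNj.apply_prod_of_isSharp hs hN.1 hX hY).1, (hMj.apply_prod_of_isSharp hs hM.1 hX hY).1]
  · refine fun N hN => ⟨fun hNj X Y hX hY => (hNj.apply_prod_of_isSharp hs hN.1 hX hY).1,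
      fun h => ⟨fun X hX => ?_, fun Y hY => ?_⟩⟩
    · rw [h X _ hX .univ, hM₂.1.2.2, mul_one]
    · rw [h _ Y .univ hY, hM₁.1.2.2, one_mul]

end Measures

end QJoint

namespace QJoint

/-! ### Hilbert–Schmidt estimates and additivity of the trace -/

section TraceClass

variable {H : Type*} [NormedAddCommGroup H] [InnerProductSpace ℂ H] [CompleteSpace H]

lemma hasSum_norm_inner_basis_sq (x : H) :
    HasSum (fun i => ‖⟪basis H i, x⟫_ℂ‖ ^ 2) (‖x‖ ^ 2) := by
  have h := (basis H).hasSum_inner_mul_inner x x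
  rw [inner_self_eq_norm_sq_to_K] at h
  have h2 := Complex.hasSum_re h
  convert h2 using 1
  · ext i
    rw [← inner_conj_symm, RCLike.norm_conj, Complex.mul_conj, Complex.normSq_eq_norm_sq,
      Complex.ofReal_re]
  · rw [← RCLike.ofReal_pow]
    rfl

/-- Both sums are iterated sums of the squared matrix elements of `A`, taken in opposite orders. -/
lemma summable_norm_sq_adjoint {A : H →L[ℂ] H} (h : Summable fun i => ‖A (basis H i)‖ ^ 2) :
    Summable fun i => ‖A.adjoint (basis H i)‖ ^ 2 := by
  let f : basisIndex H × basisIndex H → ℝ := fun q => ‖⟪basis H q.2, A (basis H q.1)⟫_ℂ‖ ^ 2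
  have hf : Summable f := by
    refine (summable_prod_of_nonneg (f := f) fun q => sq_nonneg _).2
      ⟨fun i => (hasSum_norm_inner_basis_sq (A (basis H i))).summable, h.congr fun i => ?_⟩
    exact (hasSum_norm_inner_basis_sq (A (basis H i))).tsum_eq.symm
  refine ((summable_prod_of_nonneg (f := fun q => f q.swap) fun q => sq_nonneg _).1
    hf.prod_symm).2.congr fun i => ?_
  refine Eq.trans (tsum_congr fun j => ?_)
    (hasSum_norm_inner_basis_sq (A.adjoint (basis H i))).tsum_eq
  rw [ContinuousLinearMap.adjoint_inner_right, ← inner_conj_symm, RCLike.norm_conj]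
  rfl

/-- For positive `T`, both `√T` and `√T A` are Hilbert–Schmidt, the latter through its adjoint, and
the terms are ⟨√T eᵢ, √T A eᵢ⟩. Since `tr` is a `tsum`, this summability is needed before it can be
additive, and hence before sums of normal maps are normal. -/
lemma summable_inner_mul {T : H →L[ℂ] H} (hT : T ∈ traceClass H) (A : H →L[ℂ] H) :
    Summable fun i => ⟪basis H i, (T * A) (basis H i)⟫_ℂ := by
  induction hT using Submodule.span_induction with
  | mem T hT =>
    obtain ⟨hT, hs⟩ := hT
    have h1 : Summable fun i => ‖CFC.sqrt T (basis H i)‖ ^ 2 := by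
      convert Complex.hasSum_re hs.hasSum |>.summable using 2 with i
      rw [inner_eq_inner_sqrt hT, inner_self_eq_norm_sq_to_K, ← RCLike.ofReal_pow]
      rfl
    have h2 : Summable fun i => ‖(CFC.sqrt T * A) (basis H i)‖ ^ 2 := by
      have h3 : Summable fun i => ‖(star A * CFC.sqrt T) (basis H i)‖ ^ 2 := by
        refine Summable.of_nonneg_of_le (fun i => by positivity) (fun i => ?_)
          (h1.mul_left (‖star A‖ ^ 2))
        rw [← mul_pow]
        exact pow_le_pow_left₀ (norm_nonneg _) ((star A).le_opNorm _) 2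
      have h4 := summable_norm_sq_adjoint h3
      rwa [← ContinuousLinearMap.star_eq_adjoint, star_mul, star_star,
        (CFC.sqrt_nonneg T).isSelfAdjoint.star_eq] at h4
    refine Summable.of_norm_bounded (h1.add h2) fun i => ?_
    rw [mul_apply_eq_comp, inner_eq_inner_sqrt hT]
    refine (norm_inner_le_norm _ _).trans ?_
    rw [mul_apply_eq_comp]
    nlinarith [sq_nonneg (‖CFC.sqrt T (basis H i)‖ - ‖CFC.sqrt T (A (basis H i))‖),
      sq_nonneg (‖CFC.sqrt T (basis H i)‖), sq_nonneg (‖CFC.sqrt T (A (basis H i))‖)]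
  | zero => simp
  | add S T _ _ hS hT => simpa [add_mul, inner_add_right] using hS.add hT
  | smul c T _ hT => simpa [inner_smul_right] using hT.mul_left c

lemma tr_mul_add {T : H →L[ℂ] H} (hT : T ∈ traceClass H) (A B : H →L[ℂ] H) :
    tr (T * (A + B)) = tr (T * A) + tr (T * B) := by
  unfold tr
  rw [← (summable_inner_mul hT A).tsum_add (summable_inner_mul hT B)]
  simp [mul_add]

end TraceClass

/-! ### Normal and completely positive maps -/

section CompletelyPositive

variable {K : Type*} [NormedAddCommGroup K] [InnerProductSpace ℂ K] [CompleteSpace K]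
variable {H : Type*} [NormedAddCommGroup H] [InnerProductSpace ℂ H] [CompleteSpace H]
variable {Φ Ψ : (K →L[ℂ] K) →ₗ[ℂ] (H →L[ℂ] H)}

lemma IsNormalMap.add (hΦ : IsNormalMap Φ) (hΨ : IsNormalMap Ψ) : IsNormalMap (Φ + Ψ) := by
  unfold IsNormalMap at *
  let := ultraweak K
  let := ultraweak H
  rw [continuous_induced_rng] at *
  convert hΦ.add hΨ using 1
  ext A T
  exact tr_mul_add T.2 _ _

lemma IsCP.add (hΦ : IsCP Φ) (hΨ : IsCP Ψ) : IsCP (Φ + Ψ) := by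
  intro n a φ
  simpa [inner_add_right, Finset.sum_add_distrib] using add_nonneg (hΦ n a φ) (hΨ n a φ)

lemma IsCP.nonneg (hΦ : IsCP Φ) {B : K →L[ℂ] K} (hB : 0 ≤ B) : 0 ≤ Φ B := by
  refine op_nonneg_iff.2 fun x => ?_
  have h := hΦ 1 (fun _ => CFC.sqrt B) (fun _ => x)
  simpa [(CFC.sqrt_nonneg B).isSelfAdjoint.star_eq, CFC.sqrt_mul_sqrt_self B hB] using h

lemma IsCP.map_le_map (hΦ : IsCP Φ) {A B : K →L[ℂ] K} (h : A ≤ B) : Φ A ≤ Φ B := by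
  rw [← sub_nonneg, ← map_sub]
  exact hΦ.nonneg (sub_nonneg.2 h)

lemma IsCP.map_star (hΦ : IsCP Φ) (B : K →L[ℂ] K) : Φ (star B) = star (Φ B) :=
  StarHomClass.map_star (PositiveLinearMap.mk₀ Φ fun _ h => hΦ.nonneg h) B

/-- Positive operators span, and dividing by `‖B‖ + 1` (nonzero even for `B = 0`) turns them into
effects. The swap argument needs both `B` and `1 - B` positive. -/
lemma ext_effects (h : ∀ B, 0 ≤ B → B ≤ 1 → Φ B = Ψ B) : Φ = Ψ := by
  refine LinearMap.ext_on CStarAlgebra.span_nonneg fun B (hB : 0 ≤ B) => ?_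
  have hn : (0 : ℝ) < ‖B‖ + 1 := by positivity
  have h1 : 0 ≤ ((‖B‖ + 1)⁻¹ : ℝ) • B := smul_nonneg (by positivity) hB
  have h2 := h _ h1 ((CStarAlgebra.norm_le_one_iff_of_nonneg _ h1).1 (by
    rw [norm_smul, norm_inv, Real.norm_of_nonneg hn.le, inv_mul_le_one₀ hn]
    linarith))
  rw [LinearMap.map_smul_of_tower, LinearMap.map_smul_of_tower] at h2
  exact smul_right_injective _ (inv_ne_zero (ne_of_gt hn)) h2

/-- A completely positive map that is dominated by a unital *-representation `Φ + Ψ` is of the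
form `b ↦ Φ(1) (Φ + Ψ)(b)`. -/
lemma IsCP.eq_mul_of_isStarRep_add (hΦ : IsCP Φ) (hΨ : IsCP Ψ) (hE : IsStarRep (Φ + Ψ))
    (h1 : (Φ + Ψ) 1 = 1) (b : K →L[ℂ] K) :
    Φ b = Φ 1 * (Φ + Ψ) b ∧ Φ b = (Φ + Ψ) b * Φ 1 := by
  have key : ∀ b, Φ b = Φ 1 * (Φ + Ψ) b := by
    intro b
    ext ψ
    set u := (Φ + Ψ) b ψ with hu
    -- This is the positive form of `Φ` on K-operators ⊗ H at the vector b ⊗ ψ - 1 ⊗ u. For the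
    -- representation `Φ + Ψ` it equals ‖(Φ + Ψ)(b)ψ - u‖² = 0, so it vanishes for `Φ` and `Ψ`
    -- separately.
    have hQ : ∀ {Φ : (K →L[ℂ] K) →ₗ[ℂ] (H →L[ℂ] H)}, IsCP Φ →
        0 ≤ ⟪ψ, Φ (star b * b) ψ⟫_ℂ - ⟪ψ, Φ (star b) u⟫_ℂ - ⟪u, Φ b ψ⟫_ℂ + ⟪u, Φ 1 u⟫_ℂ := by
      intro Φ hΦ
      have := hΦ 2 ![b, 1] ![ψ, -u]
      simp [Fin.sum_univ_two] at this
      convert this using 1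
      ring
    have hQ0 : (⟪ψ, Φ (star b * b) ψ⟫_ℂ - ⟪ψ, Φ (star b) u⟫_ℂ - ⟪u, Φ b ψ⟫_ℂ + ⟪u, Φ 1 u⟫_ℂ) +
        (⟪ψ, Ψ (star b * b) ψ⟫_ℂ - ⟪ψ, Ψ (star b) u⟫_ℂ - ⟪u, Ψ b ψ⟫_ℂ + ⟪u, Ψ 1 u⟫_ℂ) = 0 := by
      have e1 : ⟪ψ, (Φ + Ψ) (star b * b) ψ⟫_ℂ = ⟪u, u⟫_ℂ := by
        rw [hE.1, hE.2, mul_apply_eq_comp, ContinuousLinearMap.star_eq_adjoint,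
          ContinuousLinearMap.adjoint_inner_right]
      have e2 : ⟪ψ, (Φ + Ψ) (star b) u⟫_ℂ = ⟪u, u⟫_ℂ := by
        rw [hE.2, ContinuousLinearMap.star_eq_adjoint, ContinuousLinearMap.adjoint_inner_right]
      have e3 : ⟪u, (Φ + Ψ) b ψ⟫_ℂ = ⟪u, u⟫_ℂ := rfl
      have e4 : ⟪u, (Φ + Ψ) 1 u⟫_ℂ = ⟪u, u⟫_ℂ := by rw [h1]; rfl
      simp only [LinearMap.add_apply, add_apply, inner_add_right] at e1 e2 e3 e4
      linear_combination e1 - e2 - e3 + e4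
    have hQΦ := ((add_eq_zero_iff_of_nonneg (hQ hΦ) (hQ hΨ)).1 hQ0).1
    set w := Φ b ψ - Φ 1 u with hw
    -- Cauchy–Schwarz by hand: adding c (1 ⊗ w) to the null vector leaves only the quadratic term
    -- and a cross term 2c‖w‖², which must vanish.
    have hquad : ∀ c : ℝ, 0 ≤ (c : ℂ) ^ 2 * ⟪w, Φ 1 w⟫_ℂ + 2 * c * ⟪w, w⟫_ℂ := by
      intro c
      have := hΦ 3 ![1, b, 1] ![(c : ℂ) • w, ψ, -u]
      have e1 : ⟪ψ, Φ (star b) w⟫_ℂ - ⟪u, Φ 1 w⟫_ℂ = ⟪w, w⟫_ℂ := by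
        have hs : star (Φ 1) = Φ 1 := by rw [← hΦ.map_star, star_one]
        rw [hΦ.map_star, ← hs, ContinuousLinearMap.star_eq_adjoint,
          ContinuousLinearMap.star_eq_adjoint, ContinuousLinearMap.adjoint_inner_right,
          ContinuousLinearMap.adjoint_inner_right, ← inner_sub_left]
      have e2 : ⟪w, Φ b ψ⟫_ℂ - ⟪w, Φ 1 u⟫_ℂ = ⟪w, w⟫_ℂ := by rw [← inner_sub_right]
      simp [Fin.sum_univ_three] at this
      convert this using 1
      linear_combination (-(c : ℂ)) * e1 - (c : ℂ) * e2 - hQΦ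
    have hr : 0 ≤ ⟪w, Φ 1 w⟫_ℂ := op_nonneg_iff.1 (hΦ.nonneg zero_le_one) w
    obtain ⟨r, hr0, hr⟩ : ∃ r : ℝ, 0 ≤ r ∧ ⟪w, Φ 1 w⟫_ℂ = r :=
      ⟨_, (Complex.nonneg_iff.1 hr).1, Complex.ext rfl (Complex.nonneg_iff.1 hr).2.symm⟩
    have hquad' : ∀ c : ℝ, 0 ≤ c ^ 2 * r + 2 * c * ‖w‖ ^ 2 := by
      intro c
      have := hquad c
      rw [hr, inner_self_eq_norm_sq_to_K] at this
      refine Complex.zero_le_real.1 ?_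
      push_cast
      exact this
    have hw0 : w = 0 := by
      by_contra hne
      have hpos : 0 < ‖w‖ ^ 2 := by positivity
      -- With s = ‖w‖² / (r + 1) the value at c = -s is -s²(r + 2) < 0; the `+ 1` covers r = 0.
      have h3 := hquad' (-(‖w‖ ^ 2 / (r + 1)))
      have h4 : (‖w‖ ^ 2 / (r + 1)) * (r + 1) = ‖w‖ ^ 2 := by field_simp
      have h5 : 0 < ‖w‖ ^ 2 / (r + 1) := by positivity
      set s := ‖w‖ ^ 2 / (r + 1)
      rw [← h4] at h3
      nlinarith [mul_pos h5 h5, mul_nonneg (mul_pos h5 h5).le hr0]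
    rw [hw, sub_eq_zero] at hw0
    rw [hw0]
    rfl
  refine ⟨key b, ?_⟩
  have h2 := congrArg star (key (star b))
  rwa [star_mul, hE.2, star_star, hΦ.map_star, star_star, ← hΦ.map_star, star_one] at h2

end CompletelyPositive

/-! ### Joint instruments -/

section Instruments

variable {Ω : Type*} [MeasurableSpace Ω]
variable {H : Type*} [NormedAddCommGroup H] [InnerProductSpace ℂ H] [CompleteSpace H]
variable {K : Type*} [NormedAddCommGroup K] [InnerProductSpace ℂ K] [CompleteSpace K]
variable {Γ Δ : Set Ω → (K →L[ℂ] K) →ₗ[ℂ] (H →L[ℂ] H)} {M : Set Ω → H →L[ℂ] H}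
  {E : (K →L[ℂ] K) →ₗ[ℂ] (H →L[ℂ] H)}

variable (H K) in
/-- The instruments that vanish on the measurable sets with the property `p`. -/
def instrumentsNull (p : Set Ω → Prop) : Set (Set Ω → (K →L[ℂ] K) →ₗ[ℂ] (H →L[ℂ] H)) :=
  {Γ ∈ instruments Ω H K | ∀ X, MeasurableSet X → p X → Γ X = 0}

lemma instrumentsNull_false :
    instrumentsNull H K (fun _ : Set Ω => False) = instruments Ω H K := by
  simp [instrumentsNull]

lemma instrument_add_compl (hΓ : Γ ∈ instruments Ω H K) {X : Set Ω} (hX : MeasurableSet X) :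
    Γ X + Γ Xᶜ = Γ Set.univ := by
  ext B : 1
  simpa using (hΓ.1 B).inter_add_inter_compl .univ hX

lemma instrument_of_not_measurableSet (hΓ : Γ ∈ instruments Ω H K) {X : Set Ω}
    (hX : ¬ MeasurableSet X) : Γ X = 0 :=
  LinearMap.ext fun B => (hΓ.1 B).1 X hX

lemma instrument_ext (hΓ : Γ ∈ instruments Ω H K) (hΔ : Δ ∈ instruments Ω H K)
    (h : ∀ X, MeasurableSet X → Γ X = Δ X) : Γ = Δ := by
  ext X : 1
  by_cases hX : MeasurableSet X
  · exact h X hX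
  · rw [instrument_of_not_measurableSet hΓ hX, instrument_of_not_measurableSet hΔ hX]

/-- The common channel normalizes the mixture, E(B) + E(1 - B) = 1, and the common observable
dominates each summand, so both vanish where `M` does. -/
lemma mix_mem_observablesNull {p : Set Ω → Prop} (hM : M ∈ observablesNull H p)
    (hΓ : Γ ∈ instruments Ω H K) (hΔ : Δ ∈ instruments Ω H K) (hΓj : IsJointInstrument Γ M E)
    (hΔj : IsJointInstrument Δ M E) {B : K →L[ℂ] K} (hB : 0 ≤ B) (hB1 : B ≤ 1) :
    (fun X => Γ X B) + (fun X => Δ X (1 - B)) ∈ observablesNull H p := by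
  have hB' : 0 ≤ 1 - B := sub_nonneg.2 hB1
  refine ⟨⟨(hΓ.1 B).add (hΔ.1 _), fun X =>
    add_nonneg ((hΓ.2.2.1 X).1.nonneg hB) ((hΔ.2.2.1 X).1.nonneg hB'), ?_⟩, fun X hX hp => ?_⟩
  · change Γ Set.univ B + Δ Set.univ (1 - B) = 1
    rw [hΓj.2, hΔj.2, ← map_add, add_sub_cancel, ← hΓj.2]
    exact hΓ.2.2.2.2.2
  · have h0 : ∀ {Γ : Set Ω → (K →L[ℂ] K) →ₗ[ℂ] (H →L[ℂ] H)} {B : K →L[ℂ] K},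
        Γ ∈ instruments Ω H K → IsJointInstrument Γ M E → 0 ≤ B → B ≤ 1 → Γ X B = 0 := by
      intro Γ B hΓ hj hB hB1
      refine le_antisymm ?_ ((hΓ.2.2.1 X).1.nonneg hB)
      have := (hΓ.2.2.1 X).1.map_le_map hB1
      rwa [hj.1 X hX, hM.2 X hX hp] at this
    change Γ X B + Δ X (1 - B) = 0
    rw [h0 hΓ hΓj hB hB1, h0 hΔ hΔj hB' (sub_le_self 1 hB), add_zero]

lemma IsJointInstrument.apply_one (hM : M ∈ observables Ω H) (hΓ : Γ ∈ instruments Ω H K)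
    (hΓj : IsJointInstrument Γ M E) (X : Set Ω) : Γ X 1 = M X := by
  by_cases hX : MeasurableSet X
  · exact hΓj.1 X hX
  · rw [instrument_of_not_measurableSet hΓ hX, hM.1.1 X hX]
    rfl

lemma IsJointInstrument.unique {p : Set Ω → Prop}
    (hext : M ∈ (observablesNull H p).extremePoints ℝ ∨ E ∈ (channels K H).extremePoints ℝ)
    (hΓ : Γ ∈ instruments Ω H K) (hΔ : Δ ∈ instruments Ω H K)
    (hΓj : IsJointInstrument Γ M E) (hΔj : IsJointInstrument Δ M E) : Γ = Δ := by
  refine instrument_ext hΓ hΔ fun X hX => ?_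
  rcases hext with h | h
  · refine ext_effects fun B hB hB1 => ?_
    have h1 := eq_of_add_eq_add_self h (mix_mem_observablesNull h.1 hΓ hΔ hΓj hΔj hB hB1)
      (mix_mem_observablesNull h.1 hΔ hΓ hΔj hΓj hB hB1) (by
        ext Y : 1
        simp only [Pi.add_apply]
        nth_rewrite 1 [← hΓj.apply_one h.1.1 hΓ Y]
        rw [← hΔj.apply_one h.1.1 hΔ Y]
        simp only [map_sub]
        abel)
    have h2 : Γ X B + Δ X (1 - B) = M X := congrFun h1 X
    rw [← hΔj.1 X hX, map_sub, add_sub_left_comm, add_eq_left, sub_eq_zero] at h2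
    exact h2
  -- The swapped map is unital because `Γ` and `Δ` share the observable: Γ(X, 1) = Δ(X, 1).
  · have key : ∀ {Γ Δ : Set Ω → (K →L[ℂ] K) →ₗ[ℂ] (H →L[ℂ] H)}, Γ ∈ instruments Ω H K →
        Δ ∈ instruments Ω H K → IsJointInstrument Γ M E → IsJointInstrument Δ M E →
        Γ X + Δ Xᶜ ∈ channels K H := by
      intro Γ Δ hΓ hΔ hΓj hΔj
      refine ⟨(hΓ.2.2.1 _).1.add (hΔ.2.2.1 _).1, (hΓ.2.2.1 _).2.add (hΔ.2.2.1 _).2, ?_⟩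
      rw [LinearMap.add_apply, hΓj.1 X hX, ← hΔj.1 X hX, ← LinearMap.add_apply,
        instrument_add_compl hΔ hX]
      exact hΔ.2.2.2.2.2
    have hΓc := instrument_add_compl hΓ hX
    have hΔc := instrument_add_compl hΔ hX
    rw [hΓj.2] at hΓc
    rw [hΔj.2] at hΔc
    have h1 := eq_of_add_eq_add_self h (key hΓ hΔ hΓj hΔj) (key hΔ hΓ hΔj hΓj) (by
      refine Eq.trans ?_ (congrArg₂ (· + ·) hΓc hΔc)
      abel)
    rw [← hΔc] at h1
    exact add_right_cancel h1

/-- E = Γ(X) + Γ(Xᶜ). For sharp `M` and an effect `B`, the two summands of E(B) lie below the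
complementary projections M(X) and 1 - M(X); for a representation, Γ(X) is a completely positive
summand of it. -/
lemma IsJointInstrument.eq_mul (hs : IsSharp M ∨ IsStarRep E) (hΓ : Γ ∈ instruments Ω H K)
    (hΓj : IsJointInstrument Γ M E) {X : Set Ω} (hX : MeasurableSet X) (B : K →L[ℂ] K) :
    Γ X B = M X * E B ∧ Γ X B = E B * M X := by
  have hc := instrument_add_compl hΓ hX
  have h1 : Γ Set.univ 1 = 1 := hΓ.2.2.2.2.2
  rw [hΓj.2] at hc h1
  rcases hs with h | h
  · have key : ∀ B, 0 ≤ B → B ≤ 1 → Γ X B = M X * E B ∧ Γ X B = E B * M X := by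
      intro B hB hB1
      rw [← hc, LinearMap.add_apply]
      refine eq_mul_add_of_le_projection ((hΓ.2.2.1 _).1.nonneg hB) ((hΓ.2.2.1 _).1.nonneg hB)
        (h X hX) ?_ ?_
      · rw [← hΓj.1 X hX]
        exact (hΓ.2.2.1 _).1.map_le_map hB1
      · rw [← hΓj.1 X hX, ← h1, ← hc, LinearMap.add_apply, add_sub_cancel_left]
        exact (hΓ.2.2.1 _).1.map_le_map hB1
    exact ⟨LinearMap.congr_fun (ext_effects (Φ := Γ X) (Ψ := LinearMap.mulLeft ℂ (M X) ∘ₗ E)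
      fun B hB hB1 => (key B hB hB1).1) B,
      LinearMap.congr_fun (ext_effects (Φ := Γ X) (Ψ := LinearMap.mulRight ℂ (M X) ∘ₗ E)
      fun B hB hB1 => (key B hB hB1).2) B⟩
  · rw [← hc] at h h1 ⊢
    rw [← hΓj.1 X hX]
    exact (hΓ.2.2.1 X).1.eq_mul_of_isStarRep_add (hΓ.2.2.1 Xᶜ).1 h h1 B

lemma joint_instruments {p : Set Ω → Prop} :
    ∀ M ∈ observablesNull H p, ∀ E ∈ channels K H,
    (∃ Γ ∈ instrumentsNull H K p, IsJointInstrument Γ M E) →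
    ((M ∈ (observablesNull H p).extremePoints ℝ ∨ E ∈ (channels K H).extremePoints ℝ) →
      ∃! Γ, Γ ∈ instrumentsNull H K p ∧ IsJointInstrument Γ M E) ∧
    (M ∈ (observablesNull H p).extremePoints ℝ → E ∈ (channels K H).extremePoints ℝ →
      ∀ Γ ∈ instrumentsNull H K p, IsJointInstrument Γ M E →
        Γ ∈ (instrumentsNull H K p).extremePoints ℝ) ∧
    ((IsSharp M ∨ IsStarRep E) →
      (∀ X B, MeasurableSet X → Commute (M X) (E B)) ∧
      (∃! Γ, Γ ∈ instrumentsNull H K p ∧ IsJointInstrument Γ M E) ∧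
      ∀ Γ ∈ instrumentsNull H K p, IsJointInstrument Γ M E →
        ∀ X B, MeasurableSet X →
          Γ X B = M X * E B ∧ Γ X B = CFC.sqrt (M X) * E B * CFC.sqrt (M X)) := by
  rintro M hM E hE ⟨Γ, hΓ, hΓj⟩
  have hcomm : (IsSharp M ∨ IsStarRep E) → ∀ X B, MeasurableSet X → Commute (M X) (E B) :=
    fun hs X B hX =>
      have h := hΓj.eq_mul hs hΓ.1 hX B
      h.1.symm.trans h.2
  refine ⟨fun h => ⟨Γ, ⟨hΓ, hΓj⟩, fun Δ hΔ => hΔ.2.unique h hΔ.1.1 hΓ.1 hΓj⟩,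
    fun h₁ h₂ Γ hΓ hΓj => ⟨hΓ, ?_⟩, fun hs => ⟨hcomm hs, ⟨Γ, ⟨hΓ, hΓj⟩, ?_⟩, ?_⟩⟩
  · rintro Δ hΔ Δ' hΔ' ⟨a, b, ha, hb, hab, rfl⟩
    have hobs : ∀ {Δ : Set Ω → (K →L[ℂ] K) →ₗ[ℂ] (H →L[ℂ] H)}, Δ ∈ instrumentsNull H K p →
        (fun X => Δ X 1) ∈ observablesNull H p := fun hΔ =>
      ⟨hΔ.1.2.1, fun X hX hp => congrArg (fun Φ => Φ 1) (hΔ.2 X hX hp)⟩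
    have e₁ : (fun X => Δ X 1) = M := h₁.2 (hobs hΔ) (hobs hΔ') ⟨a, b, ha, hb, hab,
      funext fun X => hΓj.apply_one hM.1 hΓ.1 X⟩
    have e₂ : Δ Set.univ = E := h₂.2 hΔ.1.2.2.2 hΔ'.1.2.2.2 ⟨a, b, ha, hb, hab, hΓj.2⟩
    exact IsJointInstrument.unique (.inl h₁) hΔ.1 hΓ.1 ⟨fun X _ => congrFun e₁ X, e₂⟩ hΓj
  · rintro Δ ⟨hΔ, hΔj⟩
    refine instrument_ext hΔ.1 hΓ.1 fun X hX => LinearMap.ext fun B => ?_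
    rw [(hΔj.eq_mul hs hΔ.1 hX B).1, (hΓj.eq_mul hs hΓ.1 hX B).1]
  · intro Δ hΔ hΔj X B hX
    have h := (hΔj.eq_mul hs hΔ.1 hX B).1
    refine ⟨h, h.trans ?_⟩
    -- The functional calculus preserves commutation, so the square root can be moved across E(B).
    have hc : Commute (CFC.sqrt (M X)) (E B) := (hcomm hs X B hX).cfcₙ_nnreal _
    rw [mul_assoc, ← hc.eq, ← mul_assoc, CFC.sqrt_mul_sqrt_self _ (hM.1.2.1 X)]

end Instruments

end QJoint

namespace QJoint

/-! ### Pure operators -/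

section PureOperators

variable {H : Type*} [NormedAddCommGroup H] [InnerProductSpace ℂ H] [CompleteSpace H]

lemma op_ext_inner {A B : H →L[ℂ] H} (h : ∀ x, ⟪x, A x⟫_ℂ = ⟪x, B x⟫_ℂ) : A = B :=
  le_antisymm (op_le_iff.2 fun x => (h x).le) (op_le_iff.2 fun x => (h x).ge)

/-- Parseval for `√T x`, then Cauchy–Schwarz in each term |⟨√T eᵢ, x⟩|². -/
lemma inner_le_of_hasSum {T : H →L[ℂ] H} (hT : 0 ≤ T) {s : ℂ}
    (hs : HasSum (fun i => ⟪basis H i, T (basis H i)⟫_ℂ) s) (x : H) :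
    ⟪x, T x⟫_ℂ ≤ (‖x‖ ^ 2 : ℝ) * s := by
  have hsq : ∀ y, ⟪y, T y⟫_ℂ = (‖CFC.sqrt T y‖ ^ 2 : ℝ) := fun y => by
    rw [inner_eq_inner_sqrt hT, inner_self_eq_norm_sq_to_K, Complex.ofReal_pow]
    rfl
  have h1 := Complex.hasSum_ofReal.2 (hasSum_norm_inner_basis_sq (CFC.sqrt T x))
  rw [hsq x]
  refine hasSum_le (fun i => ?_) h1 (hs.mul_left _)
  rw [hsq, ← Complex.ofReal_mul, Complex.real_le_real, ← mul_pow, mul_comm ‖x‖]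
  refine pow_le_pow_left₀ (norm_nonneg _) ?_ 2
  have : ⟪basis H i, CFC.sqrt T x⟫_ℂ = ⟪CFC.sqrt T (basis H i), x⟫_ℂ := by
    rw [← ContinuousLinearMap.adjoint_inner_left, ← ContinuousLinearMap.star_eq_adjoint,
      (CFC.sqrt_nonneg T).isSelfAdjoint.star_eq]
  rw [this]
  exact norm_inner_le_norm _ _

lemma summable_of_mem_traceClass {T : H →L[ℂ] H} (hT : T ∈ traceClass H) :
    Summable fun i => ⟪basis H i, T (basis H i)⟫_ℂ := by
  simpa using summable_inner_mul hT 1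

lemma mem_traceClass_of_le {A P : H →L[ℂ] H} (hA : 0 ≤ A) (hAP : A ≤ P) (hP : P ∈ traceClass H) :
    A ∈ traceClass H := by
  refine Submodule.subset_span ⟨hA, ?_⟩
  refine Summable.of_norm_bounded (summable_of_mem_traceClass hP).norm fun i => ?_
  exact CStarAlgebra.norm_le_norm_of_nonneg_of_le (op_nonneg_iff.1 hA _) (op_le_iff.1 hAP _)

lemma eq_zero_of_tr_eq_zero {A : H →L[ℂ] H} (hA : 0 ≤ A) (hA' : A ∈ traceClass H)
    (h : tr A = 0) : A = 0 := by
  have h1 := (summable_of_mem_traceClass hA').hasSum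
  change HasSum _ (tr A) at h1
  rw [h, hasSum_zero_iff_of_nonneg fun i => op_nonneg_iff.1 hA _] at h1
  refine op_ext_inner fun x => le_antisymm ?_ (by simpa using op_nonneg_iff.1 hA x)
  have h2 := inner_le_of_hasSum hA (s := 0) (by rw [h1]; exact hasSum_zero) x
  simpa using h2

lemma tr_sub {A B : H →L[ℂ] H} (hA : A ∈ traceClass H) (hB : B ∈ traceClass H) :
    tr (A - B) = tr A - tr B := by
  unfold tr
  rw [← (summable_of_mem_traceClass hA).tsum_sub (summable_of_mem_traceClass hB)]
  simp

lemma tr_smul (c : ℂ) (A : H →L[ℂ] H) : tr (c • A) = c * tr A := by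
  unfold tr
  rw [← tsum_mul_left]
  simp

lemma tr_nonneg {A : H →L[ℂ] H} (hA : 0 ≤ A) : 0 ≤ tr A :=
  tsum_nonneg fun _ => op_nonneg_iff.1 hA _

/-- The operator `P` is nonzero and dominates no positive operators but its own multiples. -/
def IsPure (P : H →L[ℂ] H) : Prop := P ≠ 0 ∧ ∀ A, 0 ≤ A → A ≤ P → ∃ c : ℂ, A = c • P

lemma smul_mem_states {A : H →L[ℂ] H} (hA : 0 ≤ A) (hA' : A ∈ traceClass H) {r : ℝ} (hr : 0 < r)
    (h : tr A = r) : r⁻¹ • A ∈ states H := by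
  rw [← Complex.coe_smul r⁻¹ A]
  refine ⟨smul_nonneg (by exact_mod_cast (inv_pos.2 hr).le) hA, Submodule.smul_mem _ _ hA', ?_⟩
  rw [tr_smul, h, ← Complex.ofReal_mul, inv_mul_cancel₀ hr.ne', Complex.ofReal_one]

/-- P = A + (P - A) becomes a convex decomposition into states after dividing by the traces r and 1
- r; if either trace vanishes, so does that summand. -/
lemma isPure_of_mem_extremePoints {P : H →L[ℂ] H} (hP : P ∈ (states H).extremePoints ℝ) :
    IsPure P := by
  obtain ⟨⟨hP0, hPt, hP1⟩, hext⟩ := hP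
  refine ⟨?_, fun A hA hAP => ?_⟩
  · rintro rfl
    simp [tr] at hP1
  have hAt := mem_traceClass_of_le hA hAP hPt
  have hB : 0 ≤ P - A := sub_nonneg.2 hAP
  have hBt : P - A ∈ traceClass H := Submodule.sub_mem _ hPt hAt
  obtain ⟨r, hr⟩ : ∃ r : ℝ, tr A = r :=
    ⟨(tr A).re, Complex.ext rfl (Complex.nonneg_iff.1 (tr_nonneg hA)).2.symm⟩
  have hB1 : tr (P - A) = (1 - r : ℝ) := by
    rw [tr_sub hPt hAt, hP1, hr]
    simp
  have hr0 : 0 ≤ r := by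
    have := tr_nonneg hA
    rw [hr] at this
    exact_mod_cast this
  have hr1 : 0 ≤ 1 - r := by
    have := tr_nonneg hB
    rw [hB1] at this
    exact_mod_cast this
  rcases hr0.eq_or_lt with h0 | h0
  · exact ⟨0, by rw [eq_zero_of_tr_eq_zero hA hAt (by rw [hr, ← h0]; simp), zero_smul]⟩
  rcases hr1.eq_or_lt with h1 | h1
  · have h2 := eq_zero_of_tr_eq_zero hB hBt (by rw [hB1, ← h1]; simp)
    exact ⟨1, by rw [one_smul]; exact (sub_eq_zero.1 h2).symm⟩
  have h2 := hext (smul_mem_states hA hAt h0 hr) (smul_mem_states hB hBt h1 hB1)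
    ⟨r, 1 - r, h0, h1, by ring, by
      rw [smul_smul, smul_smul, mul_inv_cancel₀ h0.ne', mul_inv_cancel₀ h1.ne', one_smul,
        one_smul, add_sub_cancel]⟩
  refine ⟨r, ?_⟩
  rw [← h2, Complex.coe_smul, smul_smul, mul_inv_cancel₀ h0.ne', one_smul]

open InnerProductSpace in
-- `A` vanishes on the orthogonal complement of φ, and self-adjointness then keeps Aφ on the line of
-- φ.
lemma isPure_rankOne {φ : H} (hφ : φ ≠ 0) : IsPure (rankOne ℂ φ φ) := by
  refine ⟨rankOne_ne_zero hφ hφ, fun A hA hAP => ?_⟩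
  have hn : ⟪φ, φ⟫_ℂ ≠ 0 := inner_self_ne_zero.2 hφ
  have hperp : ∀ y, ⟪φ, y⟫_ℂ = 0 → A y = 0 := fun y hy => by
    refine apply_eq_zero_of_inner_eq_zero hA (le_antisymm ?_ (op_nonneg_iff.1 hA y))
    simpa [hy] using op_le_iff.1 hAP y
  have hproj : ∀ x, ⟪φ, x - (⟪φ, x⟫_ℂ / ⟪φ, φ⟫_ℂ) • φ⟫_ℂ = 0 := fun x => by
    rw [inner_sub_right, inner_smul_right, div_mul_cancel₀ _ hn, sub_self]
  set z := A φ - (⟪φ, A φ⟫_ℂ / ⟪φ, φ⟫_ℂ) • φ with hz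
  have hz0 : z = 0 := by
    rw [← inner_self_eq_zero (𝕜 := ℂ)]
    have h1 : ⟪z, φ⟫_ℂ = 0 := inner_eq_zero_symm.1 (hproj _)
    have h2 : ⟪z, A φ⟫_ℂ = 0 := by
      rw [← ContinuousLinearMap.adjoint_inner_left, ← ContinuousLinearMap.star_eq_adjoint,
        hA.isSelfAdjoint.star_eq, hperp z (hproj _), inner_zero_left]
    conv_lhs => rw [hz, inner_sub_right, inner_smul_right, ← hz]
    rw [h1, h2, mul_zero, sub_zero]
  rw [hz, sub_eq_zero] at hz0
  refine ⟨⟪φ, A φ⟫_ℂ / ⟪φ, φ⟫_ℂ / ⟪φ, φ⟫_ℂ, ?_⟩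
  ext x
  have h3 := hperp _ (hproj x)
  rw [map_sub, map_smul, sub_eq_zero, hz0, smul_smul] at h3
  rw [h3, smul_apply, rankOne_apply, smul_smul]
  congr 1
  ring

end PureOperators

/-! ### Partial traces for a bilinear map -/

section PartialTrace

variable {H₁ : Type*} [NormedAddCommGroup H₁] [InnerProductSpace ℂ H₁] [CompleteSpace H₁]
variable {H₂ : Type*} [NormedAddCommGroup H₂] [InnerProductSpace ℂ H₂] [CompleteSpace H₂]
variable {G : Type*} [NormedAddCommGroup G] [InnerProductSpace ℂ G] [CompleteSpace G]

/-- The partial trace over the first factor with respect to a bilinear map `τ`. -/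
noncomputable def ptrace (τ : H₁ →L[ℂ] H₂ →L[ℂ] G) (ρ : G →L[ℂ] G) : H₂ →L[ℂ] H₂ :=
  ∑' i, (τ (basis H₁ i)).adjoint ∘L ρ ∘L τ (basis H₁ i)

lemma inner_adjoint_comp_comp {F : Type*} [NormedAddCommGroup F] [InnerProductSpace ℂ F]
    [CompleteSpace F] (V W : F →L[ℂ] G) (ρ : G →L[ℂ] G) (x y : F) :
    ⟪x, (V.adjoint ∘L ρ ∘L W) y⟫_ℂ = ⟪V x, ρ (W y)⟫_ℂ := by
  rw [ContinuousLinearMap.comp_apply, ContinuousLinearMap.adjoint_inner_right,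
    ContinuousLinearMap.comp_apply]

lemma adjoint_comp_comp_nonneg {F : Type*} [NormedAddCommGroup F] [InnerProductSpace ℂ F]
    [CompleteSpace F] (V : F →L[ℂ] G) {ρ : G →L[ℂ] G} (hρ : 0 ≤ ρ) :
    0 ≤ V.adjoint ∘L ρ ∘L V :=
  op_nonneg_iff.2 fun x => by
    rw [inner_adjoint_comp_comp]
    exact op_nonneg_iff.1 hρ _

/-- For fixed x, the left quadratic form at x is that of a positive operator on `H₁` at φ, and the
right one is its trace; so `inner_le_of_hasSum` applies. -/
lemma adjoint_comp_comp_le_ptrace {τ : H₁ →L[ℂ] H₂ →L[ℂ] G} {ρ : G →L[ℂ] G} (hρ : 0 ≤ ρ)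
    (h0 : ptrace τ ρ ≠ 0) {φ : H₁} (hφ : ‖φ‖ = 1) :
    (τ φ).adjoint ∘L ρ ∘L τ φ ≤ ptrace τ ρ := by
  refine op_le_iff.2 fun x => ?_
  -- A divergent `tsum` would have the default value zero, which `h0` excludes.
  have hs : Summable fun i => (τ (basis H₁ i)).adjoint ∘L ρ ∘L τ (basis H₁ i) := by
    by_contra hs
    exact h0 (tsum_eq_zero_of_not_summable hs)
  have h1 : HasSum (fun i => ⟪x, ((τ (basis H₁ i)).adjoint ∘L ρ ∘L τ (basis H₁ i)) x⟫_ℂ)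
      ⟪x, ptrace τ ρ x⟫_ℂ :=
    (hs.hasSum.mapL (ContinuousLinearMap.apply ℂ H₂ x)).mapL (innerSL ℂ x)
  have h2 := inner_le_of_hasSum (adjoint_comp_comp_nonneg (τ.flip x) hρ)
    (s := ⟪x, ptrace τ ρ x⟫_ℂ) (by
      simpa only [inner_adjoint_comp_comp, ContinuousLinearMap.flip_apply] using h1) φ
  simpa only [inner_adjoint_comp_comp, ContinuousLinearMap.flip_apply, hφ, one_pow,
    Complex.ofReal_one, one_mul] using h2

/-- A positive operator with a pure partial trace is a product operator. -/
lemma exists_inner_eq_mul_of_isPure {τ : H₁ →L[ℂ] H₂ →L[ℂ] G} {ρ : G →L[ℂ] G} (hρ : 0 ≤ ρ)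
    (hP : IsPure (ptrace τ ρ)) : ∃ C : H₁ →L[ℂ] H₁, ∀ φ' φ ψ' ψ,
      ⟪τ φ' ψ', ρ (τ φ ψ)⟫_ℂ = ⟪φ', C φ⟫_ℂ * ⟪ψ', ptrace τ ρ ψ⟫_ℂ := by
  have hc : ∀ φ, ∃ c : ℂ, (τ φ).adjoint ∘L ρ ∘L τ φ = c • ptrace τ ρ := by
    intro φ
    by_cases hφ : φ = 0
    · exact ⟨0, by simp [hφ]⟩
    have hn : ‖φ‖ ≠ 0 := norm_ne_zero_iff.2 hφ
    obtain ⟨c, hc⟩ := hP.2 _ (adjoint_comp_comp_nonneg (τ ((‖φ‖⁻¹ : ℂ) • φ)) hρ)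
      (adjoint_comp_comp_le_ptrace hρ hP.1 (by simp [norm_smul, hn]))
    refine ⟨(‖φ‖ : ℂ) ^ 2 * c, ?_⟩
    rw [mul_smul, ← hc]
    have hn' : (‖φ‖ : ℂ) ≠ 0 := by exact_mod_cast hn
    refine op_ext_inner fun x => ?_
    rw [smul_apply, inner_smul_right, inner_adjoint_comp_comp, inner_adjoint_comp_comp, map_smul,
      smul_apply, map_smul, inner_smul_left, inner_smul_right, map_inv₀,
      Complex.conj_ofReal]
    field_simp
  choose c hc using hc
  obtain ⟨x, hx⟩ : ∃ x, ⟪x, ptrace τ ρ x⟫_ℂ ≠ 0 := by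
    by_contra! h
    exact hP.1 (op_ext_inner fun x => by simpa using h x)
  refine ⟨(⟪x, ptrace τ ρ x⟫_ℂ)⁻¹ • ((τ.flip x).adjoint ∘L ρ ∘L τ.flip x), fun φ' φ ψ' ψ => ?_⟩
  have hq : ∀ φ ψ' ψ, ⟪τ φ ψ', ρ (τ φ ψ)⟫_ℂ = c φ * ⟪ψ', ptrace τ ρ ψ⟫_ℂ := fun φ ψ' ψ => by
    rw [← inner_adjoint_comp_comp, hc, smul_apply, inner_smul_right]
  -- The scalar c(φ) is only known on the diagonal; comparing operators on `H₁` through their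
  -- quadratic forms polarizes in φ.
  have hop : (τ.flip ψ').adjoint ∘L ρ ∘L τ.flip ψ = ⟪ψ', ptrace τ ρ ψ⟫_ℂ •
      ((⟪x, ptrace τ ρ x⟫_ℂ)⁻¹ • ((τ.flip x).adjoint ∘L ρ ∘L τ.flip x)) := by
    refine op_ext_inner fun φ => ?_
    rw [smul_apply, smul_apply, inner_smul_right, inner_smul_right, inner_adjoint_comp_comp,
      inner_adjoint_comp_comp]
    simp only [ContinuousLinearMap.flip_apply, hq]
    field_simp
  have h := inner_adjoint_comp_comp (τ.flip ψ') (τ.flip ψ) ρ φ' φ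
  rw [hop, smul_apply, inner_smul_right] at h
  rw [mul_comm, h]
  rfl

lemma ptrace_flip_of_inner_eq_mul {τ : H₁ →L[ℂ] H₂ →L[ℂ] G} {ρ : G →L[ℂ] G} {C : H₁ →L[ℂ] H₁}
    {P : H₂ →L[ℂ] H₂}
    (h : ∀ φ' φ ψ' ψ, ⟪τ φ' ψ', ρ (τ φ ψ)⟫_ℂ = ⟪φ', C φ⟫_ℂ * ⟪ψ', P ψ⟫_ℂ)
    (hP : P ∈ traceClass H₂) : ptrace τ.flip ρ = tr P • C := by
  have h1 : ∀ ψ, (τ.flip ψ).adjoint ∘L ρ ∘L τ.flip ψ = ⟪ψ, P ψ⟫_ℂ • C := fun ψ =>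
    op_ext_inner fun φ => by
      rw [inner_adjoint_comp_comp, smul_apply, inner_smul_right, mul_comm]
      exact h φ φ ψ ψ
  unfold ptrace tr
  rw [tsum_congr fun j => h1 _]
  exact (summable_of_mem_traceClass hP).tsum_smul_const C

lemma inner_eq_mul_of_extreme {τ : H₁ →L[ℂ] H₂ →L[ℂ] G} {ρ : G →L[ℂ] G} (hρ : 0 ≤ ρ)
    (hP : ptrace τ ρ ∈ (states H₂).extremePoints ℝ) (φ' φ : H₁) (ψ' ψ : H₂) :
    ⟪τ φ' ψ', ρ (τ φ ψ)⟫_ℂ = ⟪φ', ptrace τ.flip ρ φ⟫_ℂ * ⟪ψ', ptrace τ ρ ψ⟫_ℂ := by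
  obtain ⟨C, hC⟩ := exists_inner_eq_mul_of_isPure hρ (isPure_of_mem_extremePoints hP)
  rw [ptrace_flip_of_inner_eq_mul hC hP.1.2.1, hP.1.2.2, one_smul, hC]

end PartialTrace

/-! ### The Hilbert space tensor product -/

section HilbertTensor

variable {H₁ : Type*} [NormedAddCommGroup H₁] [InnerProductSpace ℂ H₁]
variable {H₂ : Type*} [NormedAddCommGroup H₂] [InnerProductSpace ℂ H₂]

variable (H₁ H₂) in
/-- The canonical bilinear map into the Hilbert space tensor product. -/
noncomputable def tensorMk : H₁ →L[ℂ] H₂ →L[ℂ] HTensor H₁ H₂ :=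
  ContinuousLinearMap.compL ℂ H₂ (H₁ ⊗[ℂ] H₂) (HTensor H₁ H₂) UniformSpace.Completion.toComplL ∘L
    TensorProduct.mkL ℂ H₁ H₂

lemma HTensor.ext_inner {v w : HTensor H₁ H₂}
    (h : ∀ φ ψ, ⟪tensorMk H₁ H₂ φ ψ, v⟫_ℂ = ⟪tensorMk H₁ H₂ φ ψ, w⟫_ℂ) : v = w := by
  refine ext_inner_left ℂ fun z => ?_
  induction z using UniformSpace.Completion.induction_on with
  | hp => exact isClosed_eq (by fun_prop) (by fun_prop)
  | ih z =>
    induction z using TensorProduct.induction_on with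
    | zero => rw [UniformSpace.Completion.coe_zero, inner_zero_left, inner_zero_left]
    | tmul φ ψ => exact h φ ψ
    | add x y hx hy => rw [UniformSpace.Completion.coe_add, inner_add_left, inner_add_left, hx, hy]

lemma HTensor.op_ext {A B : HTensor H₁ H₂ →L[ℂ] HTensor H₁ H₂}
    (h : ∀ φ' φ ψ' ψ, ⟪tensorMk H₁ H₂ φ' ψ', A (tensorMk H₁ H₂ φ ψ)⟫_ℂ =
      ⟪tensorMk H₁ H₂ φ' ψ', B (tensorMk H₁ H₂ φ ψ)⟫_ℂ) : A = B := by
  ext z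
  induction z using UniformSpace.Completion.induction_on with
  | hp => exact isClosed_eq (by fun_prop) (by fun_prop)
  | ih z =>
    induction z using TensorProduct.induction_on with
    | zero => rw [UniformSpace.Completion.coe_zero, map_zero, map_zero]
    | tmul φ ψ => exact HTensor.ext_inner fun φ' ψ' => h φ' φ ψ' ψ
    | add x y hx hy => rw [UniformSpace.Completion.coe_add, map_add, map_add, hx, hy]

lemma inner_opTensor (A : H₁ →L[ℂ] H₁) (B : H₂ →L[ℂ] H₂) (φ' φ : H₁) (ψ' ψ : H₂) :
    ⟪tensorMk H₁ H₂ φ' ψ', opTensor A B (tensorMk H₁ H₂ φ ψ)⟫_ℂ =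
      ⟪φ', A φ⟫_ℂ * ⟪ψ', B ψ⟫_ℂ := by
  have h : opTensor A B (tensorMk H₁ H₂ φ ψ) = tensorMk H₁ H₂ (A φ) (B ψ) :=
    ContinuousLinearMap.completion_apply_coe _ _
  rw [h]
  exact (UniformSpace.Completion.inner_coe _ _).trans (TensorProduct.inner_tmul _ _ _ _ _)

variable [CompleteSpace H₁] [CompleteSpace H₂]

/-- The two partial traces differ by a flip of the bilinear map, so each result about `ptrace`
serves both factors. -/
lemma ptraceFst_eq (ρ : HTensor H₁ H₂ →L[ℂ] HTensor H₁ H₂) :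
    ptraceFst ρ = ptrace (tensorMk H₁ H₂) ρ := rfl

lemma ptraceSnd_eq (ρ : HTensor H₁ H₂ →L[ℂ] HTensor H₁ H₂) :
    ptraceSnd ρ = ptrace (tensorMk H₁ H₂).flip ρ := rfl

lemma eq_opTensor_of_extreme {ρ : HTensor H₁ H₂ →L[ℂ] HTensor H₁ H₂} (hρ : 0 ≤ ρ)
    (h : ptraceFst ρ ∈ (states H₂).extremePoints ℝ ∨ ptraceSnd ρ ∈ (states H₁).extremePoints ℝ) :
    ρ = opTensor (ptraceSnd ρ) (ptraceFst ρ) := by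
  refine HTensor.op_ext fun φ' φ ψ' ψ => ?_
  rw [ptraceFst_eq, ptraceSnd_eq] at h
  rw [inner_opTensor, ptraceFst_eq, ptraceSnd_eq]
  rcases h with h | h
  · exact inner_eq_mul_of_extreme hρ h φ' φ ψ' ψ
  · have h1 := inner_eq_mul_of_extreme hρ h ψ' ψ φ' φ
    rw [ContinuousLinearMap.flip_flip, ContinuousLinearMap.flip_apply,
      ContinuousLinearMap.flip_apply] at h1
    rw [mul_comm, h1]

end HilbertTensor

/-! ### No cloning and broadcasting -/

section Broadcasting

open InnerProductSpace

variable {H : Type*} [NormedAddCommGroup H] [InnerProductSpace ℂ H] [CompleteSpace H]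
variable {G : Type*} [NormedAddCommGroup G] [InnerProductSpace ℂ G] [CompleteSpace G]

lemma tr_mul_rankOne (T : H →L[ℂ] H) (x y : H) : tr (T * rankOne ℂ x y) = ⟪y, T x⟫_ℂ := by
  rw [← (basis H).tsum_inner_mul_inner y (T x)]
  exact tsum_congr fun i => by simp

lemma tr_rankOne_mul (A : H →L[ℂ] H) (x y : H) : tr (rankOne ℂ x y * A) = ⟪y, A x⟫_ℂ := by
  rw [← ContinuousLinearMap.adjoint_inner_left, ← (basis H).tsum_inner_mul_inner _ x]
  exact tsum_congr fun i => by
    rw [ContinuousLinearMap.adjoint_inner_left]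
    simp

lemma rankOne_nonneg (φ : H) : 0 ≤ rankOne ℂ φ φ :=
  (ContinuousLinearMap.nonneg_iff_isPositive _).2 (isPositive_rankOne_self φ)

lemma rankOne_mem_traceClass (φ : H) : rankOne ℂ φ φ ∈ traceClass H := by
  refine Submodule.subset_span ⟨rankOne_nonneg φ, ?_⟩
  refine ((basis H).summable_inner_mul_inner φ φ).congr fun i => ?_
  simp

lemma exists_orthogonal_of_not_smul {a b : H} (hb : b ≠ 0) (h : ∀ z : ℂ, a ≠ z • b) :
    ∃ c, ⟪c, b⟫_ℂ = 0 ∧ ⟪c, a⟫_ℂ ≠ 0 := by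
  have hn : ⟪b, b⟫_ℂ ≠ 0 := inner_self_ne_zero.2 hb
  set c := a - (⟪b, a⟫_ℂ / ⟪b, b⟫_ℂ) • b with hc
  have h1 : ⟪c, b⟫_ℂ = 0 := by
    rw [inner_eq_zero_symm, hc, inner_sub_right, inner_smul_right, div_mul_cancel₀ _ hn, sub_self]
  refine ⟨c, h1, fun h2 => ?_⟩
  have h3 : ⟪c, c⟫_ℂ = 0 := by
    nth_rewrite 2 [hc]
    rw [inner_sub_right, inner_smul_right, h1, h2, mul_zero, sub_zero]
  rw [inner_self_eq_zero, hc, sub_eq_zero] at h3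
  exact h _ h3

/-- No cloning: if `s(φ) |⟨c, φ⟩|²` is a quadratic form in `φ` for all `c`, then `s` is constant. -/
lemma eq_of_forall_inner_eq_mul {s : H → ℂ} {X : H → H →L[ℂ] H}
    (h : ∀ c φ, ⟪φ, X c φ⟫_ℂ = s φ * (⟪c, φ⟫_ℂ * ⟪φ, c⟫_ℂ)) {a b : H} (ha : a ≠ 0) (hb : b ≠ 0) :
    s a = s b := by
  -- Parallelogram law for the form with c ⊥ b and ⟨c, a⟩ ≠ 0: the term at b drops out and a ± b
  -- have the same overlap with c. Exchanging a and b then compares s(a) with s(b).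
  have half : ∀ a b : H, b ≠ 0 → (∀ z : ℂ, a ≠ z • b) → s (a + b) + s (a - b) = 2 * s a := by
    intro a b hb hab
    obtain ⟨c, hcb, hca⟩ := exists_orthogonal_of_not_smul hb hab
    have hbc := inner_eq_zero_symm.1 hcb
    have hac : ⟪a, c⟫_ℂ ≠ 0 := fun h => hca (inner_eq_zero_symm.1 h)
    have hp : ⟪a + b, X c (a + b)⟫_ℂ + ⟪a - b, X c (a - b)⟫_ℂ =
        2 * ⟪a, X c a⟫_ℂ + 2 * ⟪b, X c b⟫_ℂ := by
      simp only [map_add, map_sub, inner_add_left, inner_add_right, inner_sub_left,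
        inner_sub_right]
      ring
    rw [h, h, h, h] at hp
    simp only [inner_add_left, inner_add_right, inner_sub_left, inner_sub_right, hcb, hbc,
      add_zero, sub_zero, mul_zero] at hp
    refine mul_right_cancel₀ (mul_ne_zero hca hac) ?_
    linear_combination hp
  by_cases hd : ∃ z : ℂ, a = z • b
  · obtain ⟨z, rfl⟩ := hd
    have hz : z ≠ 0 := fun hz => ha (by rw [hz, zero_smul])
    have h1 := h b (z • b)
    rw [map_smul, inner_smul_left, inner_smul_right, h, inner_smul_left, inner_smul_right] at h1
    have hn : ⟪b, b⟫_ℂ ≠ 0 := inner_self_ne_zero.2 hb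
    have hz' : (starRingEnd ℂ) z ≠ 0 := (map_ne_zero _).2 hz
    refine mul_right_cancel₀ (mul_ne_zero (mul_ne_zero hz hz') (mul_ne_zero hn hn)) ?_
    linear_combination -h1
  · push Not at hd
    have hd' : ∀ z : ℂ, b ≠ z • a := by
      rintro z rfl
      have hz : z ≠ 0 := fun hz => hb (by rw [hz, zero_smul])
      exact hd z⁻¹ (by rw [smul_smul, inv_mul_cancel₀ hz, one_smul])
    have h1 := half a b hb hd
    have h2 := half b a ha hd'
    have h3 : s (b - a) = s (a - b) := by
      obtain ⟨c, hcb, hca⟩ := exists_orthogonal_of_not_smul hb hd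
      have hbc := inner_eq_zero_symm.1 hcb
      have hac : ⟪a, c⟫_ℂ ≠ 0 := fun h => hca (inner_eq_zero_symm.1 h)
      have h4 : ⟪b - a, X c (b - a)⟫_ℂ = ⟪a - b, X c (a - b)⟫_ℂ := by
        rw [← neg_sub a b, map_neg, inner_neg_neg]
      rw [h, h] at h4
      simp only [inner_sub_left, inner_sub_right, hcb, hbc, sub_zero, zero_sub] at h4
      refine mul_right_cancel₀ (mul_ne_zero hca hac) ?_
      linear_combination h4
    rw [h3, add_comm b a] at h2
    linear_combination (h2 - h1) / 2

/-- A Schrödinger channel that broadcasts every input to one factor has a constant output in the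
other factor. -/
lemma exists_ptrace_flip_eq {τ : H →L[ℂ] H →L[ℂ] G} {F : traceClass H →ₗ[ℂ] traceClass G}
    (hH : Nontrivial H) (hF : IsSchrodingerChannel F) (h : ∀ T, ptrace τ (F T).1 = T.1) :
    ∃ σ ∈ states H, ∀ T, ptrace τ.flip (F T).1 = tr T.1 • σ := by
  obtain ⟨E, hE, hFE⟩ := hF
  let Q : H → traceClass H := fun φ => ⟨rankOne ℂ φ φ, rankOne_mem_traceClass φ⟩
  have hQ : ∀ φ x y, ⟪y, (F (Q φ)).1 x⟫_ℂ = ⟪φ, E (rankOne ℂ x y) φ⟫_ℂ := fun φ x y => by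
    rw [← tr_mul_rankOne, hFE, tr_rankOne_mul]
  have hpos : ∀ φ, 0 ≤ (F (Q φ)).1 := fun φ => op_nonneg_iff.2 fun x => by
    rw [hQ]
    exact op_nonneg_iff.1 (hE.1.nonneg (rankOne_nonneg x)) φ
  have hC : ∀ φ, ∃ C : H →L[ℂ] H, ∀ α α' β β', ⟪τ α β, (F (Q φ)).1 (τ α' β')⟫_ℂ =
      ⟪α, C α'⟫_ℂ * (⟪β, φ⟫_ℂ * ⟪φ, β'⟫_ℂ) := by
    intro φ
    by_cases hφ : φ = 0
    · have h0 : Q φ = 0 := Subtype.ext (by simp [Q, hφ])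
      exact ⟨0, fun α α' β β' => by simp [h0]⟩
    · obtain ⟨C, hC⟩ := exists_inner_eq_mul_of_isPure (hpos φ)
        (by rw [h]; exact isPure_rankOne hφ)
      refine ⟨C, fun α α' β β' => ?_⟩
      rw [hC, h, inner_right_rankOne_apply]
  choose C hC using hC
  obtain ⟨φ₀, hφ₀⟩ := exists_ne (0 : H)
  -- Testing the output with the same c in both slots of the second factor gives the form of a
  -- single operator in the range of `E`.
  have hconst : ∀ φ, φ ≠ 0 → ∀ α α', ⟪α, C φ α'⟫_ℂ = ⟪α, C φ₀ α'⟫_ℂ := fun φ hφ α α' =>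
    eq_of_forall_inner_eq_mul (s := fun φ => ⟪α, C φ α'⟫_ℂ)
      (X := fun c => E (rankOne ℂ (τ α' c) (τ α c)))
      (fun c φ => by rw [← hQ, hC]) hφ hφ₀
  have hEC : ∀ α α' β β', E (rankOne ℂ (τ α' β') (τ α β)) =
      ⟪α, C φ₀ α'⟫_ℂ • rankOne ℂ β' β := by
    intro α α' β β'
    refine op_ext_inner fun φ => ?_
    by_cases hφ : φ = 0
    · simp [hφ]
    · rw [← hQ, hC, hconst φ hφ, smul_apply, inner_smul_right, inner_right_rankOne_apply]
      ring
  -- Duality carries the formula for `E` on rank-one operators back to all trace class inputs.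
  have hprod : ∀ (T : traceClass H) α α' β β', ⟪τ α β, (F T).1 (τ α' β')⟫_ℂ =
      ⟪α, C φ₀ α'⟫_ℂ * ⟪β, T.1 β'⟫_ℂ := fun T α α' β β' => by
    rw [← tr_mul_rankOne, hFE, hEC, mul_smul_comm, tr_smul, tr_mul_rankOne]
  have hn : ⟪φ₀, φ₀⟫_ℂ * ⟪φ₀, φ₀⟫_ℂ = (‖φ₀‖ ^ 4 : ℝ) := by
    rw [inner_self_eq_norm_sq_to_K, Complex.ofReal_pow]
    exact (pow_add _ 2 2).symm
  have hn4 : 0 < ‖φ₀‖ ^ 4 := by positivity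
  have hσ : 0 ≤ C φ₀ := op_nonneg_iff.2 fun α => by
    have := op_nonneg_iff.1 (hpos φ₀) (τ α φ₀)
    rw [hC, hn] at this
    have h1 : (0 : ℂ) ≤ ((‖φ₀‖ ^ 4)⁻¹ : ℝ) := by exact_mod_cast (inv_pos.2 hn4).le
    have h2 := mul_nonneg this h1
    rwa [mul_assoc, ← Complex.ofReal_mul, mul_inv_cancel₀ hn4.ne', Complex.ofReal_one,
      mul_one] at h2
  have hslice : ∀ α, (τ α).adjoint ∘L (F (Q φ₀)).1 ∘L τ α = ⟪α, C φ₀ α⟫_ℂ • (Q φ₀).1 :=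
    fun α => op_ext_inner fun β => by
      rw [inner_adjoint_comp_comp, smul_apply, inner_smul_right, hprod]
  have hQ0 : (Q φ₀).1 ≠ 0 := rankOne_ne_zero hφ₀ hφ₀
  have hsum : HasSum (fun i => ⟪basis H i, C φ₀ (basis H i)⟫_ℂ • (Q φ₀).1) (Q φ₀).1 := by
    have h1 := h (Q φ₀)
    unfold ptrace at h1
    rw [tsum_congr fun i => hslice _] at h1
    -- The partial trace is nonzero, so its `tsum` is not a default value; comparing coefficients of
    -- |φ₀⟩⟨φ₀| gives trace one.
    have hs : Summable fun i => ⟪basis H i, C φ₀ (basis H i)⟫_ℂ • (Q φ₀).1 := by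
      by_contra hs
      rw [tsum_eq_zero_of_not_summable hs] at h1
      exact hQ0 h1.symm
    rw [← h1]
    exact h1.symm ▸ hs.hasSum
  have htr : HasSum (fun i => ⟪basis H i, C φ₀ (basis H i)⟫_ℂ) 1 := by
    have h1 := (hsum.mapL (ContinuousLinearMap.apply ℂ H φ₀)).mapL (innerSL ℂ φ₀)
    have h2 := h1.div_const (⟪φ₀, φ₀⟫_ℂ * ⟪φ₀, φ₀⟫_ℂ)
    simpa [Q, inner_smul_right, hφ₀] using h2
  exact ⟨C φ₀, ⟨hσ, Submodule.subset_span ⟨hσ, htr.summable⟩, htr.tsum_eq⟩, fun T =>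
    ptrace_flip_of_inner_eq_mul (fun φ' φ ψ' ψ => hprod T φ' φ ψ' ψ) T.2⟩

lemma exists_ptraceSnd_eq (hH : Nontrivial H) {F : traceClass H →ₗ[ℂ] traceClass (HTensor H H)}
    (hF : IsSchrodingerChannel F) (h : ∀ T, ptraceFst (F T).1 = T.1) :
    ∃ σ ∈ states H, ∀ T, ptraceSnd (F T).1 = tr T.1 • σ := by
  simp only [ptraceFst_eq, ptraceSnd_eq] at h ⊢
  exact exists_ptrace_flip_eq hH hF h

lemma exists_ptraceFst_eq (hH : Nontrivial H) {F : traceClass H →ₗ[ℂ] traceClass (HTensor H H)}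
    (hF : IsSchrodingerChannel F) (h : ∀ T, ptraceSnd (F T).1 = T.1) :
    ∃ σ ∈ states H, ∀ T, ptraceFst (F T).1 = tr T.1 • σ := by
  simp only [ptraceFst_eq, ptraceSnd_eq] at h ⊢
  have h1 := exists_ptrace_flip_eq hH hF h
  rwa [ContinuousLinearMap.flip_flip] at h1

end Broadcasting

end QJoint

theorem mainTheorem2
    {K : Type*} [NormedAddCommGroup K] [InnerProductSpace ℂ K] [CompleteSpace K]
    [TopologicalSpace.SeparableSpace K]
    {H : Type*} [NormedAddCommGroup H] [InnerProductSpace ℂ H] [CompleteSpace H]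
    [TopologicalSpace.SeparableSpace H]
    {H₁ : Type*} [NormedAddCommGroup H₁] [InnerProductSpace ℂ H₁] [CompleteSpace H₁]
    [TopologicalSpace.SeparableSpace H₁]
    {H₂ : Type*} [NormedAddCommGroup H₂] [InnerProductSpace ℂ H₂] [CompleteSpace H₂]
    [TopologicalSpace.SeparableSpace H₂]
    {Ω : Type*} [MeasurableSpace Ω] {Ω' : Type*} [MeasurableSpace Ω']
    (ν : Measure Ω) [SigmaFinite ν] (ν' : Measure Ω') [SigmaFinite ν'] :
  (∀ ρ ∈ states (HTensor H₁ H₂),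
    (ptraceFst ρ ∈ (states H₂).extremePoints ℝ ∨ ptraceSnd ρ ∈ (states H₁).extremePoints ℝ) →
      ρ = opTensor (ptraceSnd ρ) (ptraceFst ρ)) ∧
  (∀ M₁ ∈ observablesOn H ν, ∀ M₂ ∈ observablesOn H ν',
    (∃ M ∈ observablesOn H (ν.prod ν'), IsJointObservable M M₁ M₂) →
    ((M₁ ∈ (observablesOn H ν).extremePoints ℝ ∨ M₂ ∈ (observablesOn H ν').extremePoints ℝ) →
      ∃! M, M ∈ observablesOn H (ν.prod ν') ∧ IsJointObservable M M₁ M₂) ∧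
    (M₁ ∈ (observablesOn H ν).extremePoints ℝ → M₂ ∈ (observablesOn H ν').extremePoints ℝ →
      ∀ M ∈ observablesOn H (ν.prod ν'), IsJointObservable M M₁ M₂ →
        M ∈ (observablesOn H (ν.prod ν')).extremePoints ℝ) ∧
    ((IsSharp M₁ ∨ IsSharp M₂) →
      (∀ X Y, MeasurableSet X → MeasurableSet Y → Commute (M₁ X) (M₂ Y)) ∧
      (∃! M, M ∈ observablesOn H (ν.prod ν') ∧ IsJointObservable M M₁ M₂) ∧
      ∀ M ∈ observablesOn H (ν.prod ν'), (IsJointObservable M M₁ M₂ ↔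
        ∀ X Y, MeasurableSet X → MeasurableSet Y → M (X ×ˢ Y) = M₁ X * M₂ Y))) ∧
  (∀ M₁ ∈ observables Ω H, ∀ M₂ ∈ observables Ω' H,
    (∃ M ∈ observables (Ω × Ω') H, IsJointObservable M M₁ M₂) →
    ((M₁ ∈ (observables Ω H).extremePoints ℝ ∨ M₂ ∈ (observables Ω' H).extremePoints ℝ) →
      ∃! M, M ∈ observables (Ω × Ω') H ∧ IsJointObservable M M₁ M₂) ∧
    (M₁ ∈ (observables Ω H).extremePoints ℝ → M₂ ∈ (observables Ω' H).extremePoints ℝ →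
      ∀ M ∈ observables (Ω × Ω') H, IsJointObservable M M₁ M₂ →
        M ∈ (observables (Ω × Ω') H).extremePoints ℝ) ∧
    ((IsSharp M₁ ∨ IsSharp M₂) →
      (∀ X Y, MeasurableSet X → MeasurableSet Y → Commute (M₁ X) (M₂ Y)) ∧
      (∃! M, M ∈ observables (Ω × Ω') H ∧ IsJointObservable M M₁ M₂) ∧
      ∀ M ∈ observables (Ω × Ω') H, (IsJointObservable M M₁ M₂ ↔
        ∀ X Y, MeasurableSet X → MeasurableSet Y → M (X ×ˢ Y) = M₁ X * M₂ Y))) ∧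
  (∀ M ∈ observablesOn H ν, ∀ E ∈ channels K H,
    (∃ Γ ∈ instrumentsOn H K ν, IsJointInstrument Γ M E) →
    ((M ∈ (observablesOn H ν).extremePoints ℝ ∨ E ∈ (channels K H).extremePoints ℝ) →
      ∃! Γ, Γ ∈ instrumentsOn H K ν ∧ IsJointInstrument Γ M E) ∧
    (M ∈ (observablesOn H ν).extremePoints ℝ → E ∈ (channels K H).extremePoints ℝ →
      ∀ Γ ∈ instrumentsOn H K ν, IsJointInstrument Γ M E →
        Γ ∈ (instrumentsOn H K ν).extremePoints ℝ) ∧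
    ((IsSharp M ∨ IsStarRep E) →
      (∀ X B, MeasurableSet X → Commute (M X) (E B)) ∧
      (∃! Γ, Γ ∈ instrumentsOn H K ν ∧ IsJointInstrument Γ M E) ∧
      ∀ Γ ∈ instrumentsOn H K ν, IsJointInstrument Γ M E →
        ∀ X B, MeasurableSet X →
          Γ X B = M X * E B ∧ Γ X B = CFC.sqrt (M X) * E B * CFC.sqrt (M X))) ∧
  (∀ M ∈ observables Ω H, ∀ E ∈ channels K H,
    (∃ Γ ∈ instruments Ω H K, IsJointInstrument Γ M E) →
    ((M ∈ (observables Ω H).extremePoints ℝ ∨ E ∈ (channels K H).extremePoints ℝ) →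
      ∃! Γ, Γ ∈ instruments Ω H K ∧ IsJointInstrument Γ M E) ∧
    (M ∈ (observables Ω H).extremePoints ℝ → E ∈ (channels K H).extremePoints ℝ →
      ∀ Γ ∈ instruments Ω H K, IsJointInstrument Γ M E →
        Γ ∈ (instruments Ω H K).extremePoints ℝ) ∧
    ((IsSharp M ∨ IsStarRep E) →
      (∀ X B, MeasurableSet X → Commute (M X) (E B)) ∧
      (∃! Γ, Γ ∈ instruments Ω H K ∧ IsJointInstrument Γ M E) ∧
      ∀ Γ ∈ instruments Ω H K, IsJointInstrument Γ M E →
        ∀ X B, MeasurableSet X →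
          Γ X B = M X * E B ∧ Γ X B = CFC.sqrt (M X) * E B * CFC.sqrt (M X))) ∧
  (Nontrivial H → ∀ F : traceClass H →ₗ[ℂ] traceClass (HTensor H H), IsSchrodingerChannel F →
    ((∀ T, ptraceFst (F T).1 = T.1) →
      ∃ σ ∈ states H, ∀ T, ptraceSnd (F T).1 = tr T.1 • σ) ∧
    ((∀ T, ptraceSnd (F T).1 = T.1) →
      ∃ σ ∈ states H, ∀ T, ptraceFst (F T).1 = tr T.1 • σ)) := by
  have hfst : ∀ X : Set Ω, MeasurableSet X → ν X = 0 → ν.prod ν' (Prod.fst ⁻¹' X) = 0 :=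
    fun X _ h => by rw [← Set.prod_univ, Measure.prod_prod, h, zero_mul]
  have hsnd : ∀ Y : Set Ω', MeasurableSet Y → ν' Y = 0 → ν.prod ν' (Prod.snd ⁻¹' Y) = 0 :=
    fun Y _ h => by rw [← Set.univ_prod, Measure.prod_prod, h, mul_zero]
  refine ⟨fun ρ hρ h => eq_opTensor_of_extreme hρ.1 h,
    joint_observables (p := fun X => ν X = 0) (p' := fun Y => ν' Y = 0)
      (q := fun Z => ν.prod ν' Z = 0) hfst hsnd, ?_,
    joint_instruments (p := fun X => ν X = 0), ?_,
    fun hH F hF => ⟨exists_ptraceSnd_eq hH hF, exists_ptraceFst_eq hH hF⟩⟩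
  · simp only [← observablesNull_false]
    exact joint_observables (fun _ _ h => h) (fun _ _ h => h)
  · simp only [← observablesNull_false, ← instrumentsNull_false]
    exact joint_instruments
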